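/- A (finitary algebraic) theory is a small category $\mathbb T$ with objects $X^0,X^1=X,X^2,\dots$ together with an identity-on-objects, finite product preserving functor to it from the opposite of the category of the finite sets $\{1,\dots,n\}$, $n\ge 0$; a morphism of theories $P:\mathbb T'\to\mathbb T$ is a functor compatible with these structure functors. A $\mathbb T$-model is a finite product preserving functor $\mathbb T\to\mathbf{Set}$; write $\mathbb T(n)=\hom_{\mathbb T}(X^n,-)$ for the free model on $n$ generators, with underlying set $\hom_{\mathbb T}(X^n,X)$. Composition with $P$ defines $U_P:\mathbb T\text{-}\mathbf{mod}\to\mathbb T'\text{-}\mathbf{mod}$, which has a left adjoint, again denoted $P$; put $M_P=U_PP(M)$ and let $\eta_M:M\to M_P$ be the unit. A Maltsev operation of $\mathbb T$ is a morphism $p:X^3\to X$ with $p(x,y,y)=x=p(y,y,x)$, and $\mathbb T$ is Maltsev if it has one. For an internal abelian group $G$ in a category with finite products, a $G$-torsor is an object $T$ with a $G$-action such that (action, projection) $:G\times T\to T\times T$ is an isomorphism and $T\times T\rightrightarrows T\to 1$ is a coequalizer. A morphism $E\to B$ of a category $\mathbf C$ with finite limits is an abelian extension if, in $\mathbf C/B$,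 it admits the structure of a torsor under some internal abelian group of $\mathbf C/B$; it is a central extension if that group may be taken of the form $(B\times A\to B)$ for an internal abelian group $A$ in $\mathbf C$. A natural system $D$ of abelian groups on $\mathbb T$ is a functor to abelian groups from the category whose objects are the morphisms of $\mathbb T$ and whose morphisms $b\to b'$ are the pairs $(b_1,b_2)$ with $b_1bb_2=b'$. A linear extension of $\mathbb T$ by $D$ is a morphism of theories $P:\mathbb T'\to\mathbb T$ with, for each morphism $b$ of $\mathbb T$, a simply transitive action $(x,e)\mapsto x+e$ of $D_b$ on the nonempty set $P^{-1}(b)$, such that $(x_1+e_1)(x_2+e_2)=(x_1P(e_2)+P(e_1)x_2)+e_1e_2$ for all composable $e_1,e_2$ in $\mathbb T'$ and $x_i\in D_{P(e_i)}$. It is untwisted if $D$ comes from a bifunctor $D:\mathbb T^{\mathrm{op}}\times\mathbb T\to\mathbf{Ab}$, i.e. $D_b=D(Y,Z)$ for $b:Y\to Z$. The morphism $P$ is called a linear (respectively untwisted) extension if it admits such a structure for some natural system (respectively some bifunctor) $D$. **Theorem.** Let $P:\mathbb T'\to\mathbb T$ be a morphism of Maltsev theories. The following conditions are equivalent: (i)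 $P$ is a linear (respectively, untwisted) extension; (ii) for every $\mathbb T'$-model $M$ the homomorphism $\eta_M:M\to M_P$ is an abelian (respectively, central) extension in $\mathbb T'\text{-}\mathbf{mod}$, and moreover ($\diamondsuit$) for any Maltsev operation $p$ of $\mathbb T'$, any $n,k\ge0$, any homomorphisms $u,v:\mathbb T'(n)\to\mathbb T'(k)$ of $\mathbb T'$-models with $P(u)=P(v)$, and any $x,y\in\mathbb T'(n)$ with $\eta_{\mathbb T'(n)}(x)=\eta_{\mathbb T'(n)}(y)$, one has $$p(u(x),v(x),v(y))=u(y).$$ -/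

import Mathlib

open CategoryTheory Limits Opposite

universe v u

/-! ## Torsors, abelian and central extensions in a category -/

section Torsors

open MonoidalCategory CartesianMonoidalCategory MonObj ModObj

/-- `T` is a torsor under the internal group `G` of a category with finite products: it carries an
action of `G` such that (action, projection) `G × T ⟶ T × T` is an isomorphism, and it has global
support, i.e. `T × T ⇉ T ⟶ 1` is a coequalizer. -/
def IsTorsorUnder {D : Type*} [Category* D] [CartesianMonoidalCategory D]
    (G : D) [GrpObj G] (T : D) : Prop :=
  ∃ _ : ModObj G T,
    IsIso (CartesianMonoidalCategory.lift (γ[G, T] : G ⊗ T ⟶ T) (snd G T)) ∧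
    Nonempty (IsColimit (Cofork.ofπ (f := fst T T) (g := snd T T) (toUnit T)
      (toUnit_unique _ _)))

attribute [local instance] Over.cartesianMonoidalCategory Over.braidedCategory

/-- `p : E ⟶ B` is an abelian extension: as an object of the slice over `B`, it admits the structure
of a torsor under some internal abelian group of the slice. -/
def IsAbelianExtension {C : Type*} [Category* C] [HasFiniteLimits C] {E B : C}
    (p : E ⟶ B) : Prop :=
  ∃ G : CommGrp (Over B), IsTorsorUnder G.X (Over.mk p)

/-- The constant internal abelian group `B^*(A) = (B × A ⟶ B)` of the slice over `B` given by
an internal abelian group `A`. -/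
noncomputable def constantGroup {C : Type*} [Category* C] [HasFiniteLimits C]
    [CartesianMonoidalCategory C] [BraidedCategory C] (B : C) (A : CommGrp C) :
    CommGrp (Over B) :=
  haveI : PreservesFiniteProducts (Over.star B) :=
    haveI := (Over.forgetAdjStar B).rightAdjoint_preservesLimits
    inferInstance
  letI : (Over.star B).Braided := .ofChosenFiniteProducts _
  (Over.star B).mapCommGrp.obj A

/-- `p : E ⟶ B` is a central extension: in the slice over `B` it admits the structure of a torsor
under a constant group `B^*(A)`, for some internal abelian group `A`. -/
def IsCentralExtension {C : Type*} [Category* C] [HasFiniteLimits C] {E B : C}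
    (p : E ⟶ B) : Prop :=
  letI : CartesianMonoidalCategory C := .ofHasFiniteProducts
  letI : BraidedCategory C := .ofCartesianMonoidalCategory
  ∃ A : CommGrp C, IsTorsorUnder (constantGroup B A).X (Over.mk p)

end Torsors

/-! ## Natural systems -/

/-- The twisted arrow category (category of factorizations) of `B`: objects are the morphisms
of `B`, a morphism from `b` to `b'` is a factorization of `b'` through `b`. -/
structure TwistedArrow (B : Type*) [Category* B] where
  /-- the source -/
  src : B
  /-- the target -/
  tgt : B
  /-- the morphism of `B` -/
  hom : src ⟶ tgt

namespace TwistedArrow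

variable {B : Type*} [Category* B]

/-- A factorization `l ≫ b ≫ r = b'`. -/
@[ext]
structure Hom (b b' : TwistedArrow B) where
  /-- the factor in front of `b` -/
  l : b'.src ⟶ b.src
  /-- the factor after `b` -/
  r : b.tgt ⟶ b'.tgt
  fac : l ≫ b.hom ≫ r = b'.hom

instance : Category (TwistedArrow B) where
  Hom := Hom
  id b := ⟨𝟙 _, 𝟙 _, by simp⟩
  comp f g := ⟨g.l ≫ f.l, f.r ≫ g.r, by simp [← g.fac, ← f.fac]⟩
  id_comp _ := Hom.ext (Category.comp_id _) (Category.id_comp _)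
  comp_id _ := Hom.ext (Category.id_comp _) (Category.comp_id _)
  assoc _ _ _ := Hom.ext (Category.assoc _ _ _).symm (Category.assoc _ _ _)

/-- The forgetful functor from the twisted arrow category to `Bᵒᵖ × B`. Natural systems arising
from bifunctors are the restrictions along it. -/
def toProd : TwistedArrow B ⥤ Bᵒᵖ × B where
  obj b := (op b.src, b.tgt)
  map f := (f.l.op, f.r)

/-- Precomposition with `a`, as a morphism from `b` to `a ≫ b` of the twisted arrow category. -/
def pre {X Y Z : B} (a : X ⟶ Y) (b : Y ⟶ Z) :
    (⟨Y, Z, b⟩ : TwistedArrow B) ⟶ ⟨X, Z, a ≫ b⟩ :=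
  Hom.mk a (𝟙 _) (by simp)

/-- Postcomposition with `b`, as a morphism from `a` to `a ≫ b` of the twisted arrow category. -/
def post {X Y Z : B} (a : X ⟶ Y) (b : Y ⟶ Z) :
    (⟨X, Y, a⟩ : TwistedArrow B) ⟶ ⟨X, Z, a ≫ b⟩ :=
  Hom.mk (𝟙 _) b (by simp)

end TwistedArrow

/-! ## Algebraic theories -/

/-- A finitary algebraic theory: a category with objects `X^0, X^1, X^2, ...` together with
an identity on objects functor `ofFun` from the opposite of the category of the finite
sets `Fin n`, preserving finite products; the latter means that `X^n` is, via the images of the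
maps `Fin 1 → Fin n`, the `n`-th power of the generator `X^1`. -/
structure AlgTheory : Type (u + 1) where
  /-- morphisms from `X^m` to `X^n` -/
  Hom : ℕ → ℕ → Type u
  /-- identities -/
  id (n : ℕ) : Hom n n
  /-- composition, in diagrammatic order -/
  comp {l m n : ℕ} : Hom l m → Hom m n → Hom l n
  id_comp {m n : ℕ} (f : Hom m n) : comp (id m) f = f
  comp_id {m n : ℕ} (f : Hom m n) : comp f (id n) = f
  assoc {k l m n : ℕ} (f : Hom k l) (g : Hom l m) (h : Hom m n) :
    comp (comp f g) h = comp f (comp g h)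
  /-- the structure functor -/
  ofFun {m n : ℕ} : (Fin n → Fin m) → Hom m n
  ofFun_id (n : ℕ) : ofFun (fun i : Fin n => i) = id n
  ofFun_comp {l m n : ℕ} (f : Fin m → Fin l) (g : Fin n → Fin m) :
    ofFun (fun i => f (g i)) = comp (ofFun f) (ofFun g)
  existsUnique_lift {m n : ℕ} (f : Fin n → Hom m 1) :
    ∃! g : Hom m n, ∀ i, comp g (ofFun fun _ => i) = f i

namespace AlgTheory

/-- The type of objects of a theory; the object `X^n` is the number `n`. -/
def Obj (_ : AlgTheory.{u}) : Type := ℕ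

/-- The object `X^n`. -/
def pow (T : AlgTheory.{u}) (n : ℕ) : T.Obj := n

instance (T : AlgTheory.{u}) : Category.{u} T.Obj where
  Hom := T.Hom
  id := T.id
  comp := T.comp
  id_comp := T.id_comp
  comp_id := T.comp_id
  assoc := T.assoc

/-- The morphism `X^m ⟶ X^n` given by a map of finite sets. -/
def str (T : AlgTheory.{u}) {m n : ℕ} (f : Fin n → Fin m) : T.pow m ⟶ T.pow n := T.ofFun f

/-- The projections `x_i : X^n ⟶ X`. -/
def proj (T : AlgTheory.{u}) {n : ℕ} (i : Fin n) : T.pow n ⟶ T.pow 1 := T.str fun _ => i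

lemma str_id (T : AlgTheory.{u}) (n : ℕ) : T.str (fun i : Fin n => i) = 𝟙 (T.pow n) :=
  T.ofFun_id n

lemma str_comp (T : AlgTheory.{u}) {l m n : ℕ} (f : Fin m → Fin l) (g : Fin n → Fin m) :
    T.str f ≫ T.str g = T.str fun i => f (g i) :=
  (T.ofFun_comp f g).symm

lemma existsUnique_proj (T : AlgTheory.{u}) {m : T.Obj} {n : ℕ} (f : Fin n → (m ⟶ T.pow 1)) :
    ∃! g : m ⟶ T.pow n, ∀ i, g ≫ T.proj i = f i :=
  T.existsUnique_lift f

/-- A Maltsev operation of a theory: a ternary operation `p` with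
`p(x, y, y) = x = p(y, y, x)`. -/
def IsMaltsevOp (T : AlgTheory.{u}) (p : T.pow 3 ⟶ T.pow 1) : Prop :=
  T.str ![(0 : Fin 2), 1, 1] ≫ p = T.proj 0 ∧ T.str ![(1 : Fin 2), 1, 0] ≫ p = T.proj 0

/-- A Maltsev theory. -/
def IsMaltsev (T : AlgTheory.{u}) : Prop := ∃ p, T.IsMaltsevOp p

/-- A morphism of theories: a functor which respects the structure functors (and hence is identity
on objects and preserves finite products). -/
structure Mor (T' T : AlgTheory.{u}) where
  /-- the action on morphisms -/
  map {m n : ℕ} : (T'.pow m ⟶ T'.pow n) → (T.pow m ⟶ T.pow n)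
  map_comp {l m n : ℕ} (f : T'.pow l ⟶ T'.pow m) (g : T'.pow m ⟶ T'.pow n) :
    map (f ≫ g) = map f ≫ map g
  map_str {m n : ℕ} (f : Fin n → Fin m) : map (T'.str f) = T.str f

/-- The functor underlying a morphism of theories. -/
def Mor.functor {T' T : AlgTheory.{u}} (P : Mor T' T) : T'.Obj ⥤ T.Obj where
  obj n := T.pow n
  map f := P.map f
  map_id n := by
    exact (congrArg P.map (T'.str_id n)).symm.trans ((P.map_str fun i => i).trans (T.str_id n))
  map_comp f g := P.map_comp f g

/-! ### Models -/

/-- The property of being a model in sets: preservation of finite products. -/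
def isModel (T : AlgTheory.{u}) : ObjectProperty (T.Obj ⥤ Type u) :=
  fun M => PreservesFiniteProducts M

/-- The category of models of `T` in sets: finite product preserving functors and their natural
transformations. -/
abbrev Model (T : AlgTheory.{u}) : Type (u + 1) := T.isModel.FullSubcategory

/-- The set `M(X^n)`. -/
abbrev Model.carrier {T : AlgTheory.{u}} (M : T.Model) (n : ℕ) : Type u := M.obj.obj (T.pow n)

/-- The map `M(X^n) → M(X)^n`. -/
def coords {T : AlgTheory.{u}} (M : T.Obj ⥤ Type u) (n : ℕ) (a : M.obj (T.pow n)) :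
    Fin n → M.obj (T.pow 1) :=
  fun i => M.map (T.proj i) a

/-- The projection `X^(k_1 + ... + k_n) ⟶ X^(k_i)`. -/
def sumProj (T : AlgTheory.{u}) {n : ℕ} (k : Fin n → ℕ) (i : Fin n) :
    T.pow (∑ i, k i) ⟶ T.pow (k i) :=
  T.str fun j => finSigmaFinEquiv ⟨i, j⟩

lemma str_proj (T : AlgTheory.{u}) {m n : ℕ} (f : Fin n → Fin m) (i : Fin n) :
    T.str f ≫ T.proj i = T.proj (f i) := T.str_comp _ _

lemma hom_ext (T : AlgTheory.{u}) {m : T.Obj} {n : ℕ} {f g : m ⟶ T.pow n}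
    (h : ∀ i, f ≫ T.proj i = g ≫ T.proj i) : f = g :=
  (T.existsUnique_proj fun i => g ≫ T.proj i).unique h fun _ => rfl

lemma sumProj_proj (T : AlgTheory.{u}) {n : ℕ} (k : Fin n → ℕ) (i : Fin n) (j : Fin (k i)) :
    T.sumProj k i ≫ T.proj j = T.proj (finSigmaFinEquiv ⟨i, j⟩) := T.str_proj _ _

lemma existsUnique_sumProj (T : AlgTheory.{u}) {n : ℕ} (k : Fin n → ℕ) {m : T.Obj}
    (f : ∀ i, m ⟶ T.pow (k i)) :
    ∃! g : m ⟶ T.pow (∑ i, k i), ∀ i, g ≫ T.sumProj k i = f i := by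
  obtain ⟨g, hg, _⟩ := T.existsUnique_proj fun j : Fin (∑ i, k i) =>
    f (finSigmaFinEquiv.symm j).1 ≫ T.proj (finSigmaFinEquiv.symm j).2
  refine ⟨g, fun i => T.hom_ext fun j => ?_, fun h hh => T.hom_ext fun j => ?_⟩
  · rw [Category.assoc, sumProj_proj, hg, Equiv.symm_apply_apply]
  · obtain ⟨⟨i, j⟩, rfl⟩ := finSigmaFinEquiv.surjective j
    rw [hg, ← sumProj_proj, ← Category.assoc, hh, Equiv.symm_apply_apply]

lemma isLimit_mapCone_fan_iff {C : Type*} [Category* C] (M : C ⥤ Type u) {n : ℕ}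
    {k : Fin n → C} (c : Fan k) :
    Nonempty (IsLimit (M.mapCone c)) ↔
      ∀ s : ∀ i, M.obj (k i), ∃! x : M.obj c.pt, ∀ i, M.map (c.proj i) x = s i := by
  rw [Types.isLimit_iff]
  constructor
  · intro h s
    obtain ⟨x, hx, hu⟩ := h (fun j => s j.as) (by rintro ⟨i⟩ ⟨j⟩ ⟨⟨⟨rfl⟩⟩⟩; simp)
    exact ⟨x, fun i => hx ⟨i⟩, fun y hy => hu y fun j => hy j.as⟩
  · intro h s _
    obtain ⟨x, hx, hu⟩ := h (fun i => s ⟨i⟩)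
    exact ⟨x, fun j => hx j.as, fun y hy => hu y fun j => hy ⟨j⟩⟩

lemma existsUnique_of_coords {T : AlgTheory.{u}} {M : T.Obj ⥤ Type u}
    (h : ∀ n, Function.Bijective (coords M n)) {n : ℕ} (k : Fin n → ℕ)
    (s : ∀ i, M.obj (T.pow (k i))) :
    ∃! x : M.obj (T.pow (∑ i, k i)), ∀ i, M.map (T.sumProj k i) x = s i := by
  have key (x : M.obj (T.pow (∑ i, k i))) (i : Fin n) (j : Fin (k i)) :
      coords M (k i) (M.map (T.sumProj k i) x) j =
        coords M (∑ i, k i) x (finSigmaFinEquiv ⟨i, j⟩) := by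
    simp only [coords, ← T.sumProj_proj k i j, Functor.map_comp]
    rfl
  obtain ⟨x, hx⟩ := (h (∑ i, k i)).2 fun j =>
    coords M _ (s (finSigmaFinEquiv.symm j).1) (finSigmaFinEquiv.symm j).2
  refine ⟨x, fun i => (h (k i)).1 (funext fun j => ?_), fun y hy => (h _).1 (funext fun j => ?_)⟩
  · rw [key, hx]
    dsimp only
    rw [Equiv.symm_apply_apply]
  · obtain ⟨⟨i, j⟩, rfl⟩ := finSigmaFinEquiv.surjective j
    rw [← key, hy, hx]
    dsimp only
    rw [Equiv.symm_apply_apply]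

/-- A functor to sets is a model iff the maps `M(X^n) → M(X)^n` are bijective. -/
lemma isModel_iff (T : AlgTheory.{u}) (M : T.Obj ⥤ Type u) :
    T.isModel M ↔ ∀ n, Function.Bijective (coords M n) := by
  constructor
  · intro (hM : PreservesFiniteProducts M) n
    have hl : IsLimit (Fan.mk (T.pow n) (fun i : Fin n => T.proj i)) := by
      choose l hl _ using fun (s : Fan fun _ : Fin n => T.pow 1) =>
        T.existsUnique_proj s.proj
      exact Fan.IsLimit.mk _ l (fun s i => hl s i) fun s m hm => T.hom_ext fun i =>
        (hm i).trans (hl s i).symm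
    have h := (isLimit_mapCone_fan_iff M _).1 ⟨isLimitOfPreserves M hl⟩
    rw [Function.bijective_iff_existsUnique]
    intro s
    simpa [coords, funext_iff] using! h s
  · intro h
    refine ⟨fun n => ⟨fun {K} => ?_⟩⟩
    have : PreservesLimit (Discrete.functor fun i => T.pow (K.obj ⟨i⟩)) M := by
      have hl : IsLimit (Fan.mk _ (T.sumProj fun i => K.obj ⟨i⟩)) := by
        choose l hl hu using fun (s : Fan fun i => T.pow (K.obj ⟨i⟩)) =>
          T.existsUnique_sumProj _ s.proj
        exact Fan.IsLimit.mk _ l (fun s i => hl s i) fun s m hm => hu s m hm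
      obtain ⟨hl'⟩ := (isLimit_mapCone_fan_iff M (Fan.mk _ (T.sumProj fun i => K.obj ⟨i⟩))).2
        (existsUnique_of_coords h fun i => K.obj ⟨i⟩)
      exact preservesLimit_of_preserves_limit_cone hl hl'
    exact preservesLimit_of_iso_diagram M
      (Discrete.natIso fun i => Iso.refl _ :
        Discrete.functor (fun i => T.pow (K.obj ⟨i⟩)) ≅ K)

instance (T : AlgTheory.{u}) (J : Type v) [Category* J] [HasLimitsOfShape J (Type u)] :
    T.isModel.IsClosedUnderLimitsOfShape J where
  limitsOfShape_le := by
    rintro G ⟨h⟩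
    have hd (j : J) : PreservesFiniteProducts (h.diag.obj j) := h.prop_diag_obj j
    have : PreservesFiniteProducts h.diag.flip := ⟨fun n => ⟨fun {F} => ⟨fun {c} hc =>
      ⟨evaluationJointlyReflectsLimits _
        (fun k' => isLimitOfPreserves (h.diag.obj k') hc)⟩⟩⟩⟩
    let e : h.diag.flip ⋙ lim ≅ G :=
      NatIso.ofComponents
        (fun j => (limit.isLimit (h.diag.flip.obj j)).conePointUniqueUpToIso
          (isLimitOfPreserves ((evaluation _ _).obj j) h.isLimit)) fun {i j} f => by
          refine (isLimitOfPreserves ((evaluation _ _).obj j) h.isLimit).hom_ext fun k => ?_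
          have h1 (i : T.Obj) := IsLimit.conePointUniqueUpToIso_hom_comp
            (limit.isLimit (h.diag.flip.obj i))
            (isLimitOfPreserves ((evaluation _ _).obj i) h.isLimit) k
          have h2 := (h.π.app k).naturality f
          dsimp at h1 h2 ⊢
          rw [Category.assoc, Category.assoc, h1 j, h2, ← Category.assoc, h1 i]
          exact limMap_π _ _
    exact ⟨fun n => preservesLimitsOfShape_of_natIso e⟩

instance (T : AlgTheory.{u}) : HasLimits T.Model := ⟨fun _ _ => inferInstance⟩

/-- The forgetful functor from models of `T` to models of `T'` induced by a morphism of
theories `T' → T`. -/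
def Mor.restrict {T' T : AlgTheory.{u}} (P : Mor T' T) : T.Model ⥤ T'.Model :=
  T'.isModel.lift (T.isModel.ι ⋙ (Functor.whiskeringLeft _ _ _).obj P.functor) fun M =>
    (T'.isModel_iff _).2 fun n => by
      have h := (T.isModel_iff _).1 M.2 n
      have e : coords (P.functor ⋙ M.obj) n = coords M.obj n := by
        funext a i
        exact congrArg (fun f => M.obj.map f a) (P.map_str _)
      exact e ▸ h

instance {T' T : AlgTheory.{u}} (P : Mor T' T) : PreservesLimits P.restrict := by
  have : PreservesLimits (P.restrict ⋙ T'.isModel.ι) :=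
    have : PreservesLimits T.isModel.ι := ⟨inferInstance⟩
    inferInstanceAs (PreservesLimits
      (T.isModel.ι ⋙ (Functor.whiskeringLeft _ _ (Type u)).obj P.functor))
  exact preservesLimits_of_reflects_of_preserves P.restrict T'.isModel.ι

/-- The quotient of a set-valued functor by a compatible family of relations. -/
def quotFunctor {C : Type*} [Category* C] (L : C ⥤ Type u) (r : ∀ k, L.obj k → L.obj k → Prop)
    (hr : ∀ {k l} (f : k ⟶ l) (a b), r k a b → r l (L.map f a) (L.map f b)) : C ⥤ Type u where
  obj k := Quot (r k)
  map f := ↾Quot.map (L.map f) (hr f)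
  map_id k := by
    ext ⟨a⟩
    exact congrArg (Quot.mk _) (congrArg (fun f => f a) (L.map_id k))
  map_comp f g := by
    ext ⟨a⟩
    exact congrArg (Quot.mk _) (congrArg (fun f => f a) (L.map_comp f g))

/-- The functor sending `X^k` to the set of all formal expressions `t(a)`, with `a ∈ M(X^n)`
and `t : X^n ⟶ X^k`. -/
def exprFunctor {T' : AlgTheory.{u}} (T : AlgTheory.{u}) (M : T'.Model) : T.Obj ⥤ Type u where
  obj k := Σ n : ℕ, (T.pow n ⟶ k) × M.carrier n
  map f := ↾fun x => ⟨x.1, x.2.1 ≫ f, x.2.2⟩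
  map_id k := by
    refine ConcreteCategory.hom_ext _ _ fun ⟨n, t, a⟩ => ?_
    exact congrArg (fun t => (⟨n, t, a⟩ : Σ n, (T.pow n ⟶ k) × M.carrier n)) (Category.comp_id t)
  map_comp {k l m} f g := by
    refine ConcreteCategory.hom_ext _ _ fun ⟨n, t, a⟩ => ?_
    exact congrArg (fun t => (⟨n, t, a⟩ : Σ n, (T.pow n ⟶ m) × M.carrier n))
      (Category.assoc t f g).symm

lemma solutionSet_restrict {T' T : AlgTheory.{u}} (P : Mor T' T) :
    SolutionSetCondition.{u} P.restrict := by
  intro M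
  let L := exprFunctor T M
  let good (r : ∀ k, L.obj k → L.obj k → Prop) : Prop :=
    ∃ hr : ∀ {k l} (f : k ⟶ l) (a b), r k a b → r l (L.map f a) (L.map f b),
      T.isModel (quotFunctor L r hr) ∧
      ∀ {m n : ℕ} (s : T'.pow m ⟶ T'.pow n) (a : M.carrier m),
        Quot.mk (r (T.pow n)) ⟨n, 𝟙 _, M.obj.map s a⟩ = Quot.mk _ ⟨m, 𝟙 _ ≫ P.map s, a⟩
  refine ⟨{r // good r}, fun r => ⟨quotFunctor L r.1 r.2.1, r.2.2.1⟩, fun r =>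
    ObjectProperty.homMk
      { app := fun n => ↾fun a => Quot.mk _ ⟨n, 𝟙 _, a⟩
        naturality := fun m n s => by ext a; exact r.2.2.2 s a }, fun X h => ?_⟩
  have hX := (T.isModel_iff _).1 X.2
  have hM := (T'.isModel_iff _).1 M.2
  have hnat {m n : ℕ} (s : T'.pow m ⟶ T'.pow n) (a : M.carrier m) :
      h.hom.app (T'.pow n) (M.obj.map s a) = X.obj.map (P.map s) (h.hom.app (T'.pow m) a) :=
    congrArg (fun g => g a) (h.hom.naturality s)
  let ev (k : T.Obj) (x : L.obj k) : X.obj.obj k := X.obj.map x.2.1 (h.hom.app (T'.pow x.1) x.2.2)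
  have ev_map {k l : T.Obj} (f : k ⟶ l) (x : L.obj k) :
      ev l (L.map f x) = X.obj.map f (ev k x) :=
    congrArg (fun g => g (h.hom.app (T'.pow x.1) x.2.2)) (X.obj.map_comp x.2.1 f)
  let r (k : T.Obj) (x y : L.obj k) : Prop := ev k x = ev k y
  have hr {k l : T.Obj} (f : k ⟶ l) (a b : L.obj k) (hab : r k a b) :
      r l (L.map f a) (L.map f b) := by
    show ev _ _ = ev _ _
    rw [ev_map, ev_map]
    exact congrArg _ hab
  let desc : quotFunctor L r hr ⟶ X.obj :=
    { app := fun k => ↾Quot.lift (ev k) fun _ _ h => h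
      naturality := fun k l f => by
        ext ⟨x⟩
        exact ev_map f x }
  have hdesc (k : T.Obj) : Function.Injective (desc.app k) := by
    rintro ⟨x⟩ ⟨y⟩ hxy
    exact Quot.sound hxy
  have hgood : good r := by
    refine ⟨hr, (T.isModel_iff _).2 fun n => ⟨fun x y hxy => ?_, fun s => ?_⟩, fun s a => ?_⟩
    · refine hdesc _ ((hX n).1 (funext fun i => ?_))
      have hi := congrArg (desc.app (T.pow 1)) (congrFun hxy i)
      have e (z) := congrArg (fun g => g z) (desc.naturality (T.proj i))
      exact (e x).symm.trans (hi.trans (e y))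
    · choose x hx using fun i => Quot.exists_rep (s i)
      obtain ⟨a, ha, _⟩ := existsUnique_of_coords hM (fun i => (x i).1) fun i => (x i).2.2
      obtain ⟨t, ht, _⟩ := T.existsUnique_proj fun i =>
        P.map (T'.sumProj (fun i => (x i).1) i) ≫ (x i).2.1
      refine ⟨Quot.mk _ ⟨_, t, a⟩, funext fun i => ?_⟩
      rw [← hx i]
      refine Quot.sound ?_
      have e1 := congrArg (fun f => X.obj.map f (h.hom.app (T'.pow _) a)) (ht i)
      have e2 := congrArg (fun g => g (h.hom.app (T'.pow _) a))
        (X.obj.map_comp (P.map (T'.sumProj (fun i => (x i).1) i)) (x i).2.1)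
      have e3 := congrArg (X.obj.map (x i).2.1) (hnat (T'.sumProj (fun i => (x i).1) i) a)
      have e4 := congrArg (fun b => X.obj.map (x i).2.1 (h.hom.app (T'.pow (x i).1) b)) (ha i)
      exact e1.trans (e2.trans (e3.symm.trans e4))
    · refine Quot.sound ?_
      show X.obj.map (𝟙 _) (h.hom.app _ (M.obj.map s a)) =
        X.obj.map (𝟙 _ ≫ P.map s) (h.hom.app _ a)
      rw [hnat, Category.id_comp, X.obj.map_id]
      rfl
  refine ⟨⟨r, hgood⟩, ObjectProperty.homMk desc, ?_⟩
  ext n a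
  exact congrArg (fun g => g (h.hom.app n a)) (X.obj.map_id _)

instance {T' T : AlgTheory.{u}} (P : Mor T' T) : P.restrict.IsRightAdjoint :=
  isRightAdjoint_of_preservesLimits_of_solutionSetCondition _ (solutionSet_restrict P)

/-- The left adjoint `P : T'-mod ⥤ T-mod` of the forgetful functor. -/
noncomputable def Mor.extend {T' T : AlgTheory.{u}} (P : Mor T' T) : T'.Model ⥤ T.Model :=
  P.restrict.leftAdjoint

/-- The `T'`-model `M_P`: the left adjoint followed by the forgetful functor. -/
noncomputable abbrev Mor.reflect {T' T : AlgTheory.{u}} (P : Mor T' T) (M : T'.Model) : T'.Model :=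
  P.restrict.obj (P.extend.obj M)

/-- The unit `η_M : M ⟶ M_P` of the adjunction. -/
noncomputable def Mor.unit {T' T : AlgTheory.{u}} (P : Mor T' T) (M : T'.Model) :
    M ⟶ P.reflect M :=
  (Adjunction.ofIsRightAdjoint P.restrict).unit.app M

/-- The free model `T(n) = hom(X^n, -)`. -/
def free (T : AlgTheory.{u}) (n : ℕ) : T.Model :=
  ⟨coyoneda.obj (op (T.pow n)),
    (inferInstance : PreservesFiniteProducts (coyoneda.obj (op (T.pow n))))⟩

/-- The bijection `M(X^n) ≃ M(X)^n`. -/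
noncomputable def Model.tupleEquiv {T : AlgTheory.{u}} (M : T.Model) (n : ℕ) :
    M.carrier n ≃ (Fin n → M.carrier 1) :=
  Equiv.ofBijective (coords M.obj n) ((T.isModel_iff _).1 M.2 n)

/-- The operation on a model `M` given by an `n`-ary operation `t` of the theory. -/
noncomputable def Model.operation {T : AlgTheory.{u}} (M : T.Model) {n : ℕ}
    (t : T.pow n ⟶ T.pow 1) (a : Fin n → M.carrier 1) : M.carrier 1 :=
  M.obj.map t ((M.tupleEquiv n).symm a)

/-- The underlying map of a homomorphism of models. -/
def Model.mapCarrier {T : AlgTheory.{u}} {M N : T.Model} (f : M ⟶ N) (a : M.carrier 1) :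
    N.carrier 1 :=
  f.hom.app (T.pow 1) a

/-- The condition `♢`: `p(u(x), v(x), v(y)) = u(y)` for any Maltsev operation `p` of `T'`, any
homomorphisms `u, v : T'(n) ⟶ T'(k)` with `P(u) = P(v)` and any `x, y ∈ T'(n)` with the same image
under the unit. -/
def Mor.Diamond {T' T : AlgTheory.{u}} (P : Mor T' T) : Prop :=
  ∀ p : T'.pow 3 ⟶ T'.pow 1, T'.IsMaltsevOp p →
    ∀ (n k : ℕ) (f g : T'.free n ⟶ T'.free k), P.extend.map f = P.extend.map g →
      ∀ x y : (T'.free n).carrier 1,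
        Model.mapCarrier (P.unit (T'.free n)) x = Model.mapCarrier (P.unit (T'.free n)) y →
          (T'.free k).operation p
            ![Model.mapCarrier f x, Model.mapCarrier g x, Model.mapCarrier g y] =
            Model.mapCarrier f y

/-! ### Linear extensions -/

/-- The fibre of a morphism of theories over a morphism `b`. -/
def Mor.Fiber {T' T : AlgTheory.{u}} (P : Mor T' T) {m n : ℕ} (b : T.pow m ⟶ T.pow n) : Type u :=
  {e : T'.pow m ⟶ T'.pow n // P.map e = b}

/-- Composition of elements of fibres. -/
def Mor.Fiber.comp {T' T : AlgTheory.{u}} {P : Mor T' T} {l m n : ℕ} {a : T.pow l ⟶ T.pow m}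
    {b : T.pow m ⟶ T.pow n} (d : P.Fiber a) (e : P.Fiber b) : P.Fiber (a ≫ b) :=
  ⟨d.1 ≫ e.1, by rw [P.map_comp, d.2, e.2]⟩

/-- The structure on a morphism of theories `P` of a linear extension by a natural system `D` of
abelian groups: for each morphism `b` of `T` a transitive and effective action of `D_b` on the
(nonempty) fibre over `b`, such that
`(y + e)(x + d) = (y P(d) + P(e) x) + e d` for composable `d`, `e`. -/
structure LinearExtension {T' T : AlgTheory.{u}} (P : Mor T' T)
    (D : TwistedArrow T.Obj ⥤ AddCommGrpCat.{u}) where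
  /-- the actions -/
  torsor {m n : ℕ} (b : T.pow m ⟶ T.pow n) :
    AddTorsor (D.obj ⟨T.pow m, T.pow n, b⟩) (P.Fiber b)
  vadd_comp_vadd {l m n : ℕ} {a : T.pow l ⟶ T.pow m} {b : T.pow m ⟶ T.pow n}
    (d : P.Fiber a) (e : P.Fiber b)
    (x : D.obj ⟨T.pow l, T.pow m, a⟩) (y : D.obj ⟨T.pow m, T.pow n, b⟩) :
    (x +ᵥ d).comp (y +ᵥ e) =
      (D.map (TwistedArrow.pre a b) y + D.map (TwistedArrow.post a b) x) +ᵥ d.comp e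

/-- `P` is a linear extension: it is one by some natural system of abelian groups. -/
def Mor.IsLinear {T' T : AlgTheory.{u}} (P : Mor T' T) : Prop :=
  ∃ D : TwistedArrow T.Obj ⥤ AddCommGrpCat.{u}, Nonempty (LinearExtension P D)

/-- `P` is an untwisted linear extension: it is a linear extension by a natural system arising from
a bifunctor `D : Tᵒᵖ × T ⥤ Ab`, i.e. by the natural system `D_b = D(X, Y)` for `b : X ⟶ Y`. -/
def Mor.IsUntwisted {T' T : AlgTheory.{u}} (P : Mor T' T) : Prop :=
  ∃ D : T.Objᵒᵖ × T.Obj ⥤ AddCommGrpCat.{u},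
    Nonempty (LinearExtension P (TwistedArrow.toProd ⋙ D))

end AlgTheory

/-! Fix a Maltsev operation p of T' and read p(x, y, z) as x − y + z. Both conditions of the theorem
amount to the following three properties: P is full; p commutes with all operations on suitable
triples (`Affine`); and ♢ holds. In the linear case the triples of `Affine` lie in one fibre. In the
untwisted case only x and y need to share a fibre.

Extensions and affineness. In a torsor, (x − y) + z is a natural ternary operation satisfying the
Maltsev identities. An Eckmann–Hilton argument (`eq_tri_of_natural`) identifies it with p, so p
commutes with all operations. Conversely, affineness applied to p itself is a medial law. It makes
the translations z ↦ p(x, y, z) an abelian group acting simply transitively (`Herd.Diff`). For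
surjective f these groups form an internal group over the base, or a single constant one in the
central case (`Affine.isAbelianExtension`, `Affine.isCentralExtension`).

Reduction to free models. On T'(n) the unit has the same kernel as P on hom(X^n, −). For full P the
kernel of η_M consists of the pairs s(c), s'(c) with P(s) = P(s') (`unit_eq_iff`). Hence affineness
passes from free models to all models (`affine_unit`).

From (i) to (ii). A linear extension allows differences of parallel morphisms of T' to be compared
(`Parallelism`). One finds p(x, y, z) − z = x − y. Affineness and ♢ follow because an element is
determined by its difference to a given one.

From (ii) to (i). D_b is the difference group of the fibre over b or, if untwisted, of the whole
hom-set. Functoriality on T requires that lxr − lyr depend on l and r only through P. Two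
applications of ♢ give this (`triHom_conj`). -/

/-! ## Torsors through generalized elements -/

section TorsorActions

open MonoidalCategory CartesianMonoidalCategory MonObj ModObj

/-- A simply transitive action of the group-valued functor represented by `G` on the functor
represented by `T`. -/
structure TorsorAction {D : Type*} [Category* D] [CartesianMonoidalCategory D]
    (G : D) [GrpObj G] (T : D) where
  /-- the action on generalized elements -/
  act {Z : D} : (Z ⟶ G) → (Z ⟶ T) → (Z ⟶ T)
  comp_act {Z W : D} (h : W ⟶ Z) (g : Z ⟶ G) (t : Z ⟶ T) : h ≫ act g t = act (h ≫ g) (h ≫ t)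
  one_act {Z : D} (t : Z ⟶ T) : act 1 t = t
  mul_act {Z : D} (g g' : Z ⟶ G) (t : Z ⟶ T) : act (g * g') t = act g (act g' t)
  existsUnique {Z : D} (t t' : Z ⟶ T) : ∃! g, act g t = t'

variable {D : Type*} [Category* D] [CartesianMonoidalCategory D] {G T : D} [GrpObj G]

lemma comp_lift_smul [ModObj G T] {Z W : D} (h : W ⟶ Z) (g : Z ⟶ G) (t : Z ⟶ T) :
    h ≫ lift g t ≫ (γ[G, T] : G ⊗ T ⟶ T) = lift (h ≫ g) (h ≫ t) ≫ (γ[G, T] : G ⊗ T ⟶ T) := by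
  rw [← Category.assoc, comp_lift]

lemma one_lift_smul [ModObj G T] {Z : D} (t : Z ⟶ T) :
    lift (1 : Z ⟶ G) t ≫ (γ[G, T] : G ⊗ T ⟶ T) = t := by
  have h : η[G] ▷ T ≫ (γ[G, T] : G ⊗ T ⟶ T) = (λ_ T).hom :=
    ModObj.one_smul_self G T
  have e : lift (toUnit Z) t ≫ η[G] ▷ T = lift 1 t := by
    rw [lift_whiskerRight, Hom.one_def]
  rw [← e, Category.assoc, h, leftUnitor_hom, lift_snd]

lemma mul_lift_smul [ModObj G T] {Z : D} (g g' : Z ⟶ G) (t : Z ⟶ T) :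
    lift (g * g') t ≫ (γ[G, T] : G ⊗ T ⟶ T) =
      lift g (lift g' t ≫ (γ[G, T] : G ⊗ T ⟶ T)) ≫ (γ[G, T] : G ⊗ T ⟶ T) := by
  have h : μ[G] ▷ T ≫ (γ[G, T] : G ⊗ T ⟶ T) =
      (α_ G G T).hom ≫ G ◁ (γ[G, T] : G ⊗ T ⟶ T) ≫ (γ[G, T] : G ⊗ T ⟶ T) :=
    ModObj.mul_smul_self G T
  have e : lift (lift g g') t ≫ μ[G] ▷ T = lift (g * g') t := by
    rw [lift_whiskerRight, Hom.mul_def]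
  rw [← e, Category.assoc, h, lift_lift_associator_hom_assoc, lift_whiskerLeft_assoc]

/-- The simply transitive action on generalized elements of a torsor. -/
noncomputable def TorsorAction.ofModObj [ModObj G T]
    [IsIso (CartesianMonoidalCategory.lift (γ[G, T] : G ⊗ T ⟶ T) (snd G T))] :
    TorsorAction G T where
  act g t := lift g t ≫ (γ[G, T] : G ⊗ T ⟶ T)
  comp_act := comp_lift_smul
  one_act := one_lift_smul
  mul_act := mul_lift_smul
  existsUnique {Z} t t' := by
    let φ : G ⊗ T ⟶ T ⊗ T := CartesianMonoidalCategory.lift (γ[G, T] : G ⊗ T ⟶ T) (snd G T)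
    have key (g : Z ⟶ G) (s : Z ⟶ T) :
        lift g s ≫ φ = lift (lift g s ≫ (γ[G, T] : G ⊗ T ⟶ T)) s := by
      simp [φ]
    -- The required g is the first component of the preimage of (t', t) under φ; the second
    -- component is t.
    have hinv : (lift t' t ≫ inv φ) ≫ φ = lift t' t := by simp
    have h1 : lift t' t ≫ inv φ = lift ((lift t' t ≫ inv φ) ≫ fst G T)
        ((lift t' t ≫ inv φ) ≫ snd G T) := by
      rw [← comp_lift, lift_fst_snd, Category.comp_id]
    have h2 : (lift t' t ≫ inv φ) ≫ snd G T = t := by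
      rw [h1, key] at hinv
      simpa using congrArg (· ≫ snd T T) hinv
    rw [h2] at h1
    refine ⟨(lift t' t ≫ inv φ) ≫ fst G T, ?_, fun g hg => ?_⟩
    · rw [h1, key] at hinv
      simpa using congrArg (· ≫ fst T T) hinv
    · have : lift g t ≫ φ = lift t' t := by rw [key, ← hg]
      rw [← this]
      simp

/-- The action of a group object obtained from one on generalized elements. -/
@[reducible]
def TorsorAction.modObj (a : TorsorAction G T) : ModObj G T where
  smul := a.act (fst G T) (snd G T)
  one_smul := by
    change η ▷ T ≫ a.act (fst G T) (snd G T) = (λ_ T).hom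
    rw [a.comp_act, whiskerRight_fst, whiskerRight_snd, leftUnitor_hom]
    have : fst (𝟙_ D) T ≫ η[G] = 1 := by
      rw [Hom.one_def]; congr 1; exact toUnit_unique _ _
    rw [this, a.one_act]
  mul_smul := by
    change μ ▷ T ≫ a.act (fst G T) (snd G T) =
      (α_ G G T).hom ≫ G ◁ a.act (fst G T) (snd G T) ≫ a.act (fst G T) (snd G T)
    have : fst (G ⊗ G) T ≫ μ[G] = (fst _ _ ≫ fst G G) * (fst _ _ ≫ snd G G) := by
      rw [Hom.mul_def, ← comp_lift, lift_fst_snd, Category.comp_id]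
    simp only [a.comp_act, whiskerRight_fst, whiskerRight_snd, whiskerLeft_fst, whiskerLeft_snd,
      this, a.mul_act, associator_hom_fst, associator_hom_snd_fst, associator_hom_snd_snd]

/-- By Yoneda: (action, projection) is invertible exactly when it is bijective on generalized
elements, which is simple transitivity. -/
lemma isTorsorUnder_iff : IsTorsorUnder G T ↔ Nonempty (TorsorAction G T) ∧
    Nonempty (IsColimit (Cofork.ofπ (f := fst T T) (g := snd T T) (toUnit T)
      (toUnit_unique _ _))) := by
  constructor
  · rintro ⟨i, h, h'⟩
    exact ⟨⟨.ofModObj⟩, h'⟩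
  · rintro ⟨⟨a⟩, h'⟩
    refine ⟨a.modObj, ?_, h'⟩
    refine isIso_of_yoneda_map_bijective _ fun Z => ⟨fun x y h => ?_, fun z => ?_⟩
    · have h1 := congrArg (· ≫ fst T T) h
      have h2 := congrArg (· ≫ snd T T) h
      simp only [Category.assoc, lift_fst, lift_snd] at h1 h2
      change x ≫ a.act _ _ = y ≫ a.act _ _ at h1
      rw [a.comp_act, a.comp_act, h2] at h1
      refine CartesianMonoidalCategory.hom_ext (X := G) (Y := T) _ _ ?_ ?_
      · exact (a.existsUnique (y ≫ snd G T) _).unique h1 rfl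
      · exact h2
    · obtain ⟨g, hg, _⟩ := a.existsUnique (z ≫ snd T T) (z ≫ fst T T)
      refine ⟨lift g (z ≫ snd T T), ?_⟩
      ext
      · simp only [Category.assoc, lift_fst]
        change _ ≫ a.act _ _ = _
        rw [a.comp_act, lift_fst, lift_snd, hg]
      · simp

end TorsorActions

section CentralActions

open MonoidalCategory CartesianMonoidalCategory MonObj ModObj

attribute [local instance] Over.cartesianMonoidalCategory Over.braidedCategory

/-- An action of the group-valued functor represented by `A` on the functor represented by `E`,
simply transitive on the fibres of `p`. -/
structure CentralAction {C : Type*} [Category* C] [CartesianMonoidalCategory C]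
    (A : C) [GrpObj A] {E B : C} (p : E ⟶ B) where
  /-- the action on generalized elements -/
  act {Z : C} : (Z ⟶ A) → (Z ⟶ E) → (Z ⟶ E)
  comp_act {Z W : C} (h : W ⟶ Z) (g : Z ⟶ A) (t : Z ⟶ E) : h ≫ act g t = act (h ≫ g) (h ≫ t)
  one_act {Z : C} (t : Z ⟶ E) : act 1 t = t
  mul_act {Z : C} (g g' : Z ⟶ A) (t : Z ⟶ E) : act (g * g') t = act g (act g' t)
  act_comp {Z : C} (g : Z ⟶ A) (t : Z ⟶ E) : act g t ≫ p = t ≫ p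
  existsUnique {Z : C} (t t' : Z ⟶ E) : t ≫ p = t' ≫ p → ∃! g, act g t = t'

variable {C : Type*} [Category* C] [HasFiniteLimits C]
    [CartesianMonoidalCategory C] [BraidedCategory C] {B : C}

/-- Generalized elements of the constant group `B^*(A)` are those of `A`. -/
noncomputable def constantGroupHomEquiv (A : CommGrp C) (Z : Over B) :
    (Z.left ⟶ A.X) ≃ (Z ⟶ (constantGroup B A).X) :=
  (Over.forgetAdjStar B).homEquiv Z A.X

lemma constantGroupHomEquiv_comp (A : CommGrp C) {Z W : Over B} (h : W ⟶ Z) (f : Z.left ⟶ A.X) :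
    constantGroupHomEquiv A W (h.left ≫ f) = h ≫ constantGroupHomEquiv A Z f :=
  (Over.forgetAdjStar B).homEquiv_naturality_left h f

/-- The right adjoint `Over.star B` preserves products, hence multiplication, and so does
precomposition with the unit of the adjunction. -/
lemma constantGroupHomEquiv_mul (A : CommGrp C) {Z : Over B} (f g : Z.left ⟶ A.X) :
    constantGroupHomEquiv A Z (f * g) =
      constantGroupHomEquiv A Z f * constantGroupHomEquiv A Z g := by
  have : PreservesFiniteProducts (Over.star B) :=
    have := (Over.forgetAdjStar B).rightAdjoint_preservesLimits
    inferInstance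
  let : (Over.star B).Braided := .ofChosenFiniteProducts _
  have h (f : Z.left ⟶ A.X) : constantGroupHomEquiv A Z f =
    (Over.forgetAdjStar B).unit.app Z ≫ (Over.star B).map f :=
    (Over.forgetAdjStar B).homEquiv_unit _ _ _
  rw [h, h, h]
  refine Eq.trans ?_ (MonObj.comp_mul (M := (constantGroup B A).X)
    ((Over.forgetAdjStar B).unit.app Z) _ _)
  exact congrArg _ ((Over.star B).map_mul f g)

lemma constantGroupHomEquiv_one (A : CommGrp C) (Z : Over B) :
    constantGroupHomEquiv A Z 1 = 1 := by
  have h := constantGroupHomEquiv_mul A (1 : Z.left ⟶ A.X) 1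
  rw [_root_.mul_one] at h
  exact (left_eq_mul.1 h)

/-- Maps over B into B × A are maps into A, and any t : Z ⟶ E becomes a generalized element over B
once Z carries the structure map t ≫ p. So the slice can be left altogether. -/
lemma nonempty_torsorAction_constantGroup_iff (A : CommGrp C) {E : C} (p : E ⟶ B) :
    Nonempty (TorsorAction (constantGroup B A).X (Over.mk p)) ↔
      Nonempty (CentralAction A.X p) := by
  constructor
  · rintro ⟨a⟩
    let act {Z : C} (g : Z ⟶ A.X) (t : Z ⟶ E) : Over.mk (t ≫ p) ⟶ Over.mk p :=
      a.act (constantGroupHomEquiv A (Over.mk (t ≫ p)) g) (Over.homMk t)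
    -- The structure map of Z equals s ≫ p only propositionally; naturality along the identity i
    -- compares the two presentations.
    have act_eq {Z : Over B} (g : Z.left ⟶ A.X) (t : Z ⟶ Over.mk p) (s : Z.left ⟶ E)
        (hs : t.left = s) :
        (a.act (constantGroupHomEquiv A Z g) t).left = (act g s).left := by
      subst hs
      let i : Over.mk (t.left ≫ p) ⟶ Z := Over.homMk (𝟙 _) (by simpa using (Over.w t).symm)
      have h := congrArg Over.Hom.left (a.comp_act i (constantGroupHomEquiv A Z g) t)
      rw [← constantGroupHomEquiv_comp] at h
      have h1 : i.left ≫ g = g := Category.id_comp _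
      have h2 : i ≫ t = (Over.homMk t.left : Over.mk (t.left ≫ p) ⟶ Over.mk p) := by
        ext; exact Category.id_comp _
      rw [h1, h2] at h
      exact (Category.id_comp _).symm.trans h
    refine ⟨⟨fun g t => (act g t).left, ?_, ?_, ?_, ?_, ?_⟩⟩
    · intro Z W h g t
      let k : Over.mk ((h ≫ t) ≫ p) ⟶ Over.mk (t ≫ p) := Over.homMk h (by simp)
      have e := congrArg Over.Hom.left (a.comp_act k (constantGroupHomEquiv A _ g)
        (Over.homMk t : Over.mk (t ≫ p) ⟶ Over.mk p))
      rw [← constantGroupHomEquiv_comp] at e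
      exact e.trans (act_eq (Z := Over.mk ((h ≫ t) ≫ p)) (h ≫ g) (k ≫ Over.homMk t) (h ≫ t) rfl)
    · intro Z t
      have h := a.one_act (Over.homMk t : Over.mk (t ≫ p) ⟶ Over.mk p)
      rw [← constantGroupHomEquiv_one] at h
      exact congrArg Over.Hom.left h
    · intro Z g g' t
      have h := a.mul_act (constantGroupHomEquiv A _ g) (constantGroupHomEquiv A _ g')
        (Over.homMk t : Over.mk (t ≫ p) ⟶ Over.mk p)
      rw [← constantGroupHomEquiv_mul] at h
      exact (congrArg Over.Hom.left h).trans
        (act_eq (Z := Over.mk (t ≫ p)) g (act g' t) (act g' t).left rfl)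
    · intro Z g t
      exact Over.w (act g t)
    · intro Z t t' h
      obtain ⟨g, hg, hu⟩ := a.existsUnique (Over.homMk t : Over.mk (t ≫ p) ⟶ Over.mk p)
        (Over.homMk t' h.symm)
      refine ⟨(constantGroupHomEquiv A (Over.mk (t ≫ p))).symm g, ?_, fun g' hg' => ?_⟩
      · dsimp only [act]
        rw [Equiv.apply_symm_apply, hg]
        rfl
      · rw [Equiv.eq_symm_apply]
        refine hu _ ?_
        ext
        exact hg'
  · rintro ⟨a⟩
    refine ⟨⟨fun {Z} g t => Over.homMk (a.act ((constantGroupHomEquiv A Z).symm g) t.left)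
      ((a.act_comp _ _).trans (Over.w t)), ?_, ?_, ?_, ?_⟩⟩
    · intro Z W h g t
      ext
      refine (a.comp_act h.left _ _).trans ?_
      obtain ⟨g, rfl⟩ := (constantGroupHomEquiv A Z).surjective g
      rw [← constantGroupHomEquiv_comp, Equiv.symm_apply_apply]
      simp
    · intro Z t
      ext
      have h : (constantGroupHomEquiv A Z).symm 1 = 1 := by
        rw [Equiv.symm_apply_eq, constantGroupHomEquiv_one]
      change a.act ((constantGroupHomEquiv A Z).symm 1) t.left = _
      rw [h, a.one_act]
    · intro Z g g' t
      ext
      obtain ⟨g, rfl⟩ := (constantGroupHomEquiv A Z).surjective g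
      obtain ⟨g', rfl⟩ := (constantGroupHomEquiv A Z).surjective g'
      rw [← constantGroupHomEquiv_mul]
      simp [a.mul_act]
    · intro Z t t'
      obtain ⟨g, hg, hu⟩ := a.existsUnique t.left t'.left ((Over.w t).trans (Over.w t').symm)
      refine ⟨constantGroupHomEquiv A Z g, ?_, fun g' hg' => ?_⟩
      · ext
        simpa using hg
      · rw [← Equiv.symm_apply_eq]
        exact (hu _ (congrArg Over.Hom.left hg'))

end CentralActions

namespace AlgTheory

/-! ## Elements of models -/

section Elements

variable {T : AlgTheory.{u}}

namespace Model

/-- The action of a morphism of the theory on the elements of a model. -/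
def app (M : T.Model) {m n : ℕ} (t : T.pow m ⟶ T.pow n) (a : M.carrier m) : M.carrier n :=
  M.obj.map t a

lemma app_id (M : T.Model) {n : ℕ} (a : M.carrier n) : M.app (𝟙 (T.pow n)) a = a :=
  congrArg (fun g => g a) (M.obj.map_id (T.pow n))

lemma app_comp (M : T.Model) {l m n : ℕ} (s : T.pow l ⟶ T.pow m) (t : T.pow m ⟶ T.pow n)
    (a : M.carrier l) : M.app (s ≫ t) a = M.app t (M.app s a) :=
  congrArg (fun g => g a) (M.obj.map_comp s t)

/-- The action of a homomorphism on the elements of a model. -/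
def homApp {M N : T.Model} (f : M ⟶ N) {n : ℕ} (a : M.carrier n) : N.carrier n :=
  f.hom.app (T.pow n) a

lemma homApp_app {M N : T.Model} (f : M ⟶ N) {m n : ℕ} (t : T.pow m ⟶ T.pow n)
    (a : M.carrier m) : homApp f (M.app t a) = N.app t (homApp f a) :=
  congrArg (fun g => g a) (f.hom.naturality t)

lemma hom_ext {M N : T.Model} {f g : M ⟶ N}
    (h : ∀ (n : ℕ) (a : M.carrier n), homApp f a = homApp g a) : f = g := by
  ext n a
  exact h n a

/-- A homomorphism of models given by its action on elements. -/
def mkHom {M N : T.Model} (f : ∀ n : ℕ, M.carrier n → N.carrier n)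
    (h : ∀ {m n : ℕ} (t : T.pow m ⟶ T.pow n) (a : M.carrier m),
      f n (M.app t a) = N.app t (f m a)) : M ⟶ N :=
  ObjectProperty.homMk
    { app := fun n => ↾f n
      naturality := fun m n t => by ext a; exact h t a }

/-- The homomorphism from a free model corresponding to an element. -/
def point {M : T.Model} {n : ℕ} (a : M.carrier n) : T.free n ⟶ M :=
  mkHom (M := T.free n) (fun _ s => M.app s a) fun t s => M.app_comp s t a

/-- The element corresponding to a homomorphism from a free model. -/
def elt {M : T.Model} {n : ℕ} (f : T.free n ⟶ M) : M.carrier n :=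
  homApp f (show (T.free n).carrier n from 𝟙 (T.pow n))

lemma elt_point {M : T.Model} {n : ℕ} (a : M.carrier n) : elt (point a) = a := M.app_id a

lemma homApp_free {M : T.Model} {n k : ℕ} (f : T.free n ⟶ M) (s : T.pow n ⟶ T.pow k) :
    homApp f (show (T.free n).carrier k from s) = M.app s (elt f) := by
  refine Eq.trans ?_ (homApp_app f s (show (T.free n).carrier n from 𝟙 (T.pow n)))
  exact congrArg _ (Category.id_comp s).symm

lemma point_elt {M : T.Model} {n : ℕ} (f : T.free n ⟶ M) : point (elt f) = f :=
  hom_ext fun _ s => (homApp_free f s).symm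

lemma elt_comp {M N : T.Model} {n : ℕ} (f : T.free n ⟶ M) (g : M ⟶ N) :
    elt (f ≫ g) = homApp g (elt f) := rfl

lemma point_comp {M N : T.Model} {n : ℕ} (a : M.carrier n) (g : M ⟶ N) :
    point a ≫ g = point (homApp g a) := by
  rw [← point_elt (point a ≫ g), elt_comp, elt_point]

/-- The homomorphism of free models given by a morphism of the theory. -/
def freeMap {m n : ℕ} (t : T.pow m ⟶ T.pow n) : T.free n ⟶ T.free m :=
  point (M := T.free m) t

lemma freeMap_point {M : T.Model} {m n : ℕ} (t : T.pow m ⟶ T.pow n) (a : M.carrier m) :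
    freeMap t ≫ point a = point (M.app t a) := point_comp _ _

/-- The element of `M(X^n)` with given coordinates. -/
noncomputable def tuple (M : T.Model) {n : ℕ} (a : Fin n → M.carrier 1) : M.carrier n :=
  (M.tupleEquiv n).symm a

lemma app_proj_tuple (M : T.Model) {n : ℕ} (a : Fin n → M.carrier 1) (i : Fin n) :
    M.app (T.proj i) (M.tuple a) = a i :=
  congrFun ((M.tupleEquiv n).apply_symm_apply a) i

lemma elt_ext {M : T.Model} {n : ℕ} {x y : M.carrier n}
    (h : ∀ i : Fin n, M.app (T.proj i) x = M.app (T.proj i) y) : x = y :=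
  (M.tupleEquiv n).injective (funext h)

lemma app_str_tuple (M : T.Model) {m n : ℕ} (f : Fin n → Fin m) (a : Fin m → M.carrier 1) :
    M.app (T.str f) (M.tuple a) = M.tuple fun i => a (f i) :=
  elt_ext fun i => by rw [← app_comp, str_proj, app_proj_tuple, app_proj_tuple]

lemma homApp_tuple {M N : T.Model} (f : M ⟶ N) {n : ℕ} (a : Fin n → M.carrier 1) :
    homApp f (M.tuple a) = N.tuple fun i => homApp f (a i) :=
  elt_ext fun i => by rw [← homApp_app, app_proj_tuple, app_proj_tuple]

lemma tuple_app_proj (M : T.Model) {n : ℕ} (x : M.carrier n) :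
    M.tuple (fun i => M.app (T.proj i) x) = x :=
  elt_ext fun i => by rw [app_proj_tuple]

lemma app_proj_zero (M : T.Model) (x : M.carrier 1) : M.app (T.proj (0 : Fin 1)) x = x := by
  have : T.proj (0 : Fin 1) = 𝟙 (T.pow 1) := by
    rw [← T.str_id]
    exact congrArg T.str (funext fun i => Subsingleton.elim _ _)
  rw [this, app_id]

/-- A ternary operation applied to elements of `M(X^n)` coordinatewise. -/
noncomputable def tri (M : T.Model) (p : T.pow 3 ⟶ T.pow 1) {n : ℕ} (x y z : M.carrier n) :
    M.carrier n :=
  M.tuple fun i => M.app p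
    (M.tuple ![M.app (T.proj i) x, M.app (T.proj i) y, M.app (T.proj i) z])

variable {M N : T.Model} {p : T.pow 3 ⟶ T.pow 1} {n : ℕ}

lemma app_proj_tri (x y z : M.carrier n) (i : Fin n) : M.app (T.proj i) (M.tri p x y z) =
    M.app p (M.tuple ![M.app (T.proj i) x, M.app (T.proj i) y, M.app (T.proj i) z]) :=
  app_proj_tuple _ _ _

lemma tri_one (x y z : M.carrier 1) : M.tri p x y z = M.app p (M.tuple ![x, y, z]) := by
  rw [← M.app_proj_zero (M.tri p x y z), app_proj_tri]
  simp only [app_proj_zero]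

lemma app_proj_tri' (x y z : M.carrier n) (i : Fin n) : M.app (T.proj i) (M.tri p x y z) =
    M.tri p (M.app (T.proj i) x) (M.app (T.proj i) y) (M.app (T.proj i) z) := by
  rw [app_proj_tri, tri_one]

lemma tri_right (hp : T.IsMaltsevOp p) (x y : M.carrier n) : M.tri p x y y = x := by
  refine elt_ext fun i => ?_
  rw [app_proj_tri]
  have h := M.app_str_tuple ![(0 : Fin 2), 1, 1] ![M.app (T.proj i) x, M.app (T.proj i) y]
  rw [show (fun j => ![M.app (T.proj i) x, M.app (T.proj i) y] (![(0 : Fin 2), 1, 1] j)) =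
    ![M.app (T.proj i) x, M.app (T.proj i) y, M.app (T.proj i) y] from
    funext fun j => by fin_cases j <;> rfl] at h
  rw [← h, ← app_comp, hp.1, app_proj_tuple]
  rfl

lemma tri_left (hp : T.IsMaltsevOp p) (x y : M.carrier n) : M.tri p y y x = x := by
  refine elt_ext fun i => ?_
  rw [app_proj_tri]
  have h := M.app_str_tuple ![(1 : Fin 2), 1, 0] ![M.app (T.proj i) x, M.app (T.proj i) y]
  rw [show (fun j => ![M.app (T.proj i) x, M.app (T.proj i) y] (![(1 : Fin 2), 1, 0] j)) =
    ![M.app (T.proj i) y, M.app (T.proj i) y, M.app (T.proj i) x] from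
    funext fun j => by fin_cases j <;> rfl] at h
  rw [← h, ← app_comp, hp.2, app_proj_tuple]
  rfl

lemma homApp_tri (f : M ⟶ N) (x y z : M.carrier n) :
    homApp f (M.tri p x y z) = N.tri p (homApp f x) (homApp f y) (homApp f z) := by
  unfold tri
  rw [homApp_tuple]
  congr 1
  funext i
  rw [homApp_app, homApp_tuple]
  congr 2
  funext j
  fin_cases j <;> exact homApp_app _ _ _

/-- On triples `x`, `y`, `z` with `f x = f y` (and `f y = f z` if `c` holds) the operation `p`
commutes with all operations. For true `c` this says that `p` is a homomorphism on the fibres of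
`f`, for false `c` it is a centrality condition. -/
def Affine (p : T.pow 3 ⟶ T.pow 1) (f : M ⟶ N) (c : Prop) : Prop :=
  ∀ ⦃m n : ℕ⦄ (t : T.pow m ⟶ T.pow n) (x y z : M.carrier m), homApp f x = homApp f y →
    (c → homApp f y = homApp f z) → M.app t (M.tri p x y z) =
      M.tri p (M.app t x) (M.app t y) (M.app t z)

lemma homApp_app_congr {f : M ⟶ N} {m n : ℕ} {x y : M.carrier m} (h : homApp f x = homApp f y)
    (t : T.pow m ⟶ T.pow n) : homApp f (M.app t x) = homApp f (M.app t y) := by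
  rw [homApp_app, h, homApp_app]

lemma homApp_tuple_congr {f : M ⟶ N} {m : ℕ} {x y : Fin m → M.carrier 1}
    (h : ∀ i, homApp f (x i) = homApp f (y i)) : homApp f (M.tuple x) = homApp f (M.tuple y) := by
  rw [homApp_tuple, homApp_tuple, funext h]

/-- An operation on triples as in `Affine`, natural with respect to the theory and satisfying the
Maltsev identities, coincides with any Maltsev operation. -/
lemma eq_tri_of_natural (hp : T.IsMaltsevOp p) (f : M ⟶ N) (c : Prop)
    (q : ∀ {n : ℕ} (x y z : M.carrier n), homApp f x = homApp f y →
      (c → homApp f y = homApp f z) → M.carrier n)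
    (hq : ∀ {m n : ℕ} (t : T.pow m ⟶ T.pow n) (x y z : M.carrier m) (h : homApp f x = homApp f y)
      (h' : c → homApp f y = homApp f z), M.app t (q x y z h h') =
        q (M.app t x) (M.app t y) (M.app t z) (homApp_app_congr h t)
          fun hc => homApp_app_congr (h' hc) t)
    (hr : ∀ {n : ℕ} (x y : M.carrier n) (h : homApp f x = homApp f y), q x y y h (fun _ => rfl) = x)
    (hl : ∀ {n : ℕ} (y z : M.carrier n) (h : c → homApp f y = homApp f z), q y y z rfl h = z)
    {n : ℕ} (x y z : M.carrier n) (h : homApp f x = homApp f y)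
    (h' : c → homApp f y = homApp f z) : q x y z h h' = M.tri p x y z := by
  have key (x y z : M.carrier 1) (h : homApp f x = homApp f y)
      (h' : c → homApp f y = homApp f z) : q x y z h h' = M.app p (M.tuple ![x, y, z]) := by
    have hA : homApp f (M.tuple ![x, y, y]) = homApp f (M.tuple ![y, y, y]) :=
      homApp_tuple_congr fun i => by fin_cases i <;> first | exact h | rfl
    have hB : c → homApp f (M.tuple ![y, y, y]) = homApp f (M.tuple ![y, y, z]) := fun hc =>
      homApp_tuple_congr fun i => by fin_cases i <;> first | exact h' hc | rfl
    -- Eckmann–Hilton: coordinatewise, q of the triples (x, y, y), (y, y, y), (y, y, z) is (x, y,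
    -- z). Naturality of q for p turns p(x, y, z) into q(p(x, y, y), p(y, y, y), p(y, y, z)) = q(x,
    -- y, z).
    have e1 : q _ _ _ hA hB = M.tuple ![x, y, z] := by
      refine elt_ext fun i => ?_
      rw [hq]
      simp only [app_proj_tuple]
      fin_cases i
      · exact hr x y h
      · exact hr y y rfl
      · exact hl y z h'
    have e2 := hq p _ _ _ hA hB
    rw [e1] at e2
    rw [e2]
    have a1 : M.app p (M.tuple ![x, y, y]) = x := by rw [← tri_one, tri_right hp]
    have a2 : M.app p (M.tuple ![y, y, y]) = y := by rw [← tri_one, tri_right hp]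
    have a3 : M.app p (M.tuple ![y, y, z]) = z := by rw [← tri_one, tri_left hp]
    simp only [a1, a2, a3]
  refine elt_ext fun i => ?_
  rw [hq, key, app_proj_tri]

lemma affine_of_natural (hp : T.IsMaltsevOp p) (f : M ⟶ N) (c : Prop)
    (q : ∀ {n : ℕ} (x y z : M.carrier n), homApp f x = homApp f y →
      (c → homApp f y = homApp f z) → M.carrier n)
    (hq : ∀ {m n : ℕ} (t : T.pow m ⟶ T.pow n) (x y z : M.carrier m) (h : homApp f x = homApp f y)
      (h' : c → homApp f y = homApp f z), M.app t (q x y z h h') =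
        q (M.app t x) (M.app t y) (M.app t z) (homApp_app_congr h t)
          fun hc => homApp_app_congr (h' hc) t)
    (hr : ∀ {n : ℕ} (x y : M.carrier n) (h : homApp f x = homApp f y), q x y y h (fun _ => rfl) = x)
    (hl : ∀ {n : ℕ} (y z : M.carrier n) (h : c → homApp f y = homApp f z), q y y z rfl h = z) :
    Affine p f c := by
  intro m n t x y z h h'
  rw [← eq_tri_of_natural hp f c q hq hr hl x y z h h', hq,
    eq_tri_of_natural hp f c q hq hr hl]

namespace Affine

variable {f : M ⟶ N} {c : Prop}

/-- This is affineness for the operation t = p, with the three triples regarded as elements of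
M(X³), one coordinate j at a time. -/
lemma medial (ha : Affine p f c) (x y z : Fin 3 → M.carrier n)
    (h : ∀ i, homApp f (x i) = homApp f (y i))
    (h' : c → ∀ i, homApp f (y i) = homApp f (z i)) :
    M.tri p (M.tri p (x 0) (y 0) (z 0)) (M.tri p (x 1) (y 1) (z 1)) (M.tri p (x 2) (y 2) (z 2)) =
      M.tri p (M.tri p (x 0) (x 1) (x 2)) (M.tri p (y 0) (y 1) (y 2))
        (M.tri p (z 0) (z 1) (z 2)) := by
  refine elt_ext fun j => ?_
  simp only [app_proj_tri']
  have key := ha p (M.tuple fun i => M.app (T.proj j) (x i))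
    (M.tuple fun i => M.app (T.proj j) (y i))
    (M.tuple fun i => M.app (T.proj j) (z i))
    (homApp_tuple_congr fun i => homApp_app_congr (h i) _)
    (fun hc => homApp_tuple_congr fun i => homApp_app_congr (h' hc i) _)
  have e (b : M.carrier 3) : M.app p b =
      M.tri p (M.app (T.proj 0) b) (M.app (T.proj 1) b) (M.app (T.proj 2) b) := by
    conv_lhs => rw [← M.tuple_app_proj b]
    rw [tri_one]
    congr 2
    funext i
    fin_cases i <;> rfl
  simpa only [e, app_proj_tri', app_proj_tuple] using key

lemma tri_assoc (ha : Affine p f c) (hp : T.IsMaltsevOp p) {x y z w v : M.carrier n}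
    (h : homApp f x = homApp f y)
    (h1 : c → homApp f y = homApp f z) (h2 : c → homApp f z = homApp f w)
    (h3 : c → homApp f w = homApp f v) :
    M.tri p (M.tri p x y z) w v = M.tri p x y (M.tri p z w v) := by
  -- The padding by y collapses under the Maltsev identities, leaving associativity.
  have := ha.medial ![x, y, y] ![y, y, y] ![z, w, v]
    (fun i => by fin_cases i <;> first | exact h | rfl)
    (fun hc i => by
      fin_cases i
      · exact h1 hc
      · exact (h1 hc).trans (h2 hc)
      · exact (h1 hc).trans ((h2 hc).trans (h3 hc)))
  simpa [tri_left hp, tri_right hp] using this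

lemma tri_comm (ha : Affine p f c) (hp : T.IsMaltsevOp p) {x y z w v : M.carrier n}
    (h : homApp f x = homApp f y)
    (h1 : c → homApp f y = homApp f z) (h2 : c → homApp f z = homApp f w)
    (h3 : c → homApp f w = homApp f v) :
    M.tri p x y (M.tri p z w v) = M.tri p z w (M.tri p x y v) := by
  -- Here the padding by x leaves commutativity of the translations by x − y and z − w.
  have := ha.medial ![x, x, x] ![x, x, y] ![z, w, v]
    (fun i => by fin_cases i <;> first | exact h | rfl)
    (fun hc i => by
      fin_cases i
      · exact h.trans (h1 hc)
      · exact h.trans ((h1 hc).trans (h2 hc))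
      · exact (h1 hc).trans ((h2 hc).trans (h3 hc)))
  simpa [tri_left hp, tri_right hp] using this.symm

end Affine

end Model

end Elements

/-! ## Abelian and central extensions of models: necessary conditions -/

section Extraction

open MonoidalCategory CartesianMonoidalCategory MonObj ModObj

attribute [local instance] Over.cartesianMonoidalCategory Over.braidedCategory

variable {T : AlgTheory.{u}}

namespace Model

/-- A model given by its sets of elements and the action of the theory on them. -/
def ofApp (X : ℕ → Type u) (a : ∀ {m n : ℕ}, (T.pow m ⟶ T.pow n) → X m → X n)
    (a_id : ∀ {n : ℕ} (x : X n), a (𝟙 (T.pow n)) x = x)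
    (a_comp : ∀ {l m n : ℕ} (s : T.pow l ⟶ T.pow m) (t : T.pow m ⟶ T.pow n) (x : X l),
      a (s ≫ t) x = a t (a s x))
    (h : ∀ n : ℕ, Function.Bijective fun (x : X n) (i : Fin n) => a (T.proj i) x) : T.Model :=
  ⟨{ obj := fun n => X n
     map := fun {m n} t => ↾(a (m := m) (n := n) t)
     map_id := fun n => by ext x; exact a_id x
     map_comp := fun s t => by ext x; exact a_comp s t x }, (T.isModel_iff _).2 h⟩

variable {E B : T.Model}

/-- The image of a homomorphism of models. -/
noncomputable def image (f : E ⟶ B) : T.Model :=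
  ofApp (fun n => {b : B.carrier n // ∃ e : E.carrier n, homApp f e = b})
    (fun t b => ⟨B.app t b.1, b.2.imp' (E.app t) fun e he => by rw [homApp_app, he]⟩)
    (fun b => Subtype.ext (B.app_id b.1)) (fun s t b => Subtype.ext (B.app_comp s t b.1))
    fun n => ⟨fun x y h => Subtype.ext (elt_ext fun i => congrArg Subtype.val (congrFun h i)),
      fun y => by
        choose e he using fun i => (y i).2
        refine ⟨⟨B.tuple fun i => (y i).1, E.tuple e, ?_⟩, funext fun i =>
          Subtype.ext (B.app_proj_tuple _ i)⟩
        rw [homApp_tuple, funext he]⟩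

/-- The corestriction of a homomorphism to its image. -/
noncomputable def toImage (f : E ⟶ B) : E ⟶ image f :=
  mkHom (N := image f) (fun _ e => ⟨homApp f e, e, rfl⟩) fun t e => Subtype.ext (homApp_app f t e)

/-- The inclusion of the image of a homomorphism. -/
noncomputable def imageι (f : E ⟶ B) : image f ⟶ B :=
  mkHom (M := image f) (fun _ b => b.1) fun _ _ => rfl

lemma toImage_imageι (f : E ⟶ B) : toImage f ≫ imageι f = f := rfl

/-- The map E → image f coequalizes the two projections of E ×_B E, so it descends to the terminal
object of the slice. This gives a section of the inclusion of the image. -/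
lemma surjective_of_isColimit (f : E ⟶ B)
    (h : Nonempty (IsColimit (Cofork.ofπ (f := fst (Over.mk f) (Over.mk f))
      (g := snd (Over.mk f) (Over.mk f)) (toUnit (Over.mk f)) (toUnit_unique _ _))))
    (n : ℕ) : Function.Surjective (homApp f (n := n)) := by
  obtain ⟨h⟩ := h
  let π : Over.mk f ⟶ Over.mk (imageι f) := Over.homMk (toImage f) (toImage_imageι f)
  have hπ : fst (Over.mk f) (Over.mk f) ≫ π = snd (Over.mk f) (Over.mk f) ≫ π := by
    have h1 := Over.w (fst (Over.mk f) (Over.mk f) ≫ π)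
    have h2 := Over.w (snd (Over.mk f) (Over.mk f) ≫ π)
    ext1
    refine hom_ext fun n a => Subtype.ext ?_
    have h3 := h1.trans h2.symm
    exact congrArg (fun g => homApp g a) h3
  let s : 𝟙_ (Over B) ⟶ Over.mk (imageι f) := h.desc (Cofork.ofπ π hπ)
  intro b
  have hb : homApp (imageι f) (homApp s.left b) = b :=
    congrArg (fun g => homApp g b) (Over.w s)
  obtain ⟨e, he⟩ := (homApp s.left b).2
  exact ⟨e, he.trans hb⟩

lemma isColimit_of_surjective (f : E ⟶ B)
    (hf : ∀ n : ℕ, Function.Surjective (homApp f (n := n))) :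
    Nonempty (IsColimit (Cofork.ofπ (f := fst (Over.mk f) (Over.mk f))
      (g := snd (Over.mk f) (Over.mk f)) (toUnit (Over.mk f)) (toUnit_unique _ _))) := by
  -- A pair x, y with equal image is a generalized element of E ×_B E defined on a free model, so k
  -- identifies x and y. This makes the descended map independent of the chosen set-theoretic
  -- section.
  have key {W : Over B} (k : Over.mk f ⟶ W)
      (hk : fst (Over.mk f) (Over.mk f) ≫ k = snd (Over.mk f) (Over.mk f) ≫ k) {n : ℕ}
      (x y : E.carrier n) (h : homApp f x = homApp f y) : homApp k.left x = homApp k.left y := by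
    let a : Over.mk (point (homApp f x)) ⟶ Over.mk f := Over.homMk (point x) (point_comp x f)
    let b : Over.mk (point (homApp f x)) ⟶ Over.mk f :=
      Over.homMk (point y) ((point_comp y f).trans (by rw [h]; rfl))
    have e : a ≫ k = b ≫ k := by
      have := congrArg (fun z => lift a b ≫ z) hk
      simpa using this
    have e' := congrArg (fun z => elt (Over.Hom.left z)) e
    change elt (point x ≫ k.left) = elt (point y ≫ k.left) at e'
    rwa [elt_comp, elt_comp, elt_point, elt_point] at e'
  choose s hs using hf
  refine ⟨Cofork.IsColimit.mk' _ fun c => ?_⟩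
  have hc {n : ℕ} := key c.π c.condition (n := n)
  let d : B ⟶ c.pt.left := mkHom (fun n b => homApp c.π.left (s n b)) fun t b => by
    rw [← homApp_app]
    exact hc _ _ ((hs _ _).trans ((homApp_app f t _).trans (congrArg _ (hs _ _))).symm)
  refine ⟨Over.homMk d (hom_ext fun n b => ?_), ?_, ?_⟩
  · refine Eq.trans (congrArg (fun g => homApp g (s n b)) (Over.w c.π)) ?_
    exact hs n b
  · ext1
    refine hom_ext fun n e => ?_
    exact hc _ _ (hs _ _)
  · intro m hm
    ext1
    refine hom_ext fun n b => ?_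
    have := congrArg (fun g => homApp (Over.Hom.left g) (s n b)) hm
    refine Eq.trans ?_ this
    change homApp m.left b = homApp m.left (homApp f (s n b))
    rw [hs]

theorem _root_.IsAbelianExtension.surjective {f : E ⟶ B} (h : IsAbelianExtension f) (n : ℕ) :
    Function.Surjective (homApp f (n := n)) := by
  obtain ⟨G, hG⟩ := h
  exact surjective_of_isColimit f (isTorsorUnder_iff.1 hG).2 n

theorem _root_.IsCentralExtension.surjective {f : E ⟶ B} (h : IsCentralExtension f) (n : ℕ) :
    Function.Surjective (homApp f (n := n)) := by
  obtain ⟨G, hG⟩ := h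
  exact surjective_of_isColimit f (isTorsorUnder_iff.1 hG).2 n

/-- Elements of E over b are generalized elements defined on the free model over b. The torsor
provides g with g · y = x, and q(x, y, z) = g · z satisfies the hypotheses of `affine_of_natural`.
-/
theorem _root_.IsAbelianExtension.affine {f : E ⟶ B} (h : IsAbelianExtension f)
    {p : T.pow 3 ⟶ T.pow 1} (hp : T.IsMaltsevOp p) : Affine p f True := by
  obtain ⟨G, hG⟩ := h
  obtain ⟨⟨a⟩, -⟩ := isTorsorUnder_iff.1 hG
  let pt {n : ℕ} (b : B.carrier n) (x : E.carrier n) (h : homApp f x = b) :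
    Over.mk (point b) ⟶ Over.mk f := Over.homMk (point x) ((point_comp x f).trans (by rw [h]; rfl))
  choose g hg hu using fun (n : ℕ) (b : B.carrier n) x (hx : homApp f x = b) y
    (hy : homApp f y = b) => a.existsUnique (pt b x hx) (pt b y hy)
  let q {n : ℕ} (x y z : E.carrier n) (h : homApp f x = homApp f y)
      (h' : True → homApp f y = homApp f z) : E.carrier n :=
    elt (a.act (g n (homApp f y) y rfl x h) (pt (homApp f y) z (h' trivial).symm)).left
  refine affine_of_natural hp f True q ?_ ?_ ?_
  · intro m n t x y z h h'
    let k : Over.mk (point (homApp f (E.app t y))) ⟶ Over.mk (point (homApp f y)) :=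
      Over.homMk (freeMap t) ((freeMap_point t _).trans (by rw [← homApp_app]; rfl))
    have hk (w : E.carrier m) (hw : homApp f w = homApp f y) : k ≫ pt (homApp f y) w hw =
        pt (homApp f (E.app t y)) (E.app t w) (homApp_app_congr hw t) := by
      ext1
      exact freeMap_point t w
    have e := a.comp_act k (g m (homApp f y) y rfl x h) (pt (homApp f y) z (h' trivial).symm)
    have e1 := hu _ _ (E.app t y) rfl (E.app t x) (homApp_app_congr h t)
      (k ≫ g m (homApp f y) y rfl x h) (by
        change a.act _ _ = _
        rw [← hk y rfl, ← a.comp_act, hg, hk x h])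
    rw [e1, hk z (h' trivial).symm] at e
    refine Eq.trans ?_ (congrArg (fun z => elt (Over.Hom.left z)) e)
    dsimp only [q]
    change _ = elt (freeMap t ≫ _)
    rw [elt_comp]
    exact (homApp_free (M := E) _ _).symm.trans (congrArg _ (Category.comp_id _).symm)
  · intro n x y h
    dsimp only [q]
    rw [hg]
    exact elt_point x
  · intro n y z h
    have e := hu n (homApp f y) y rfl y rfl 1 (a.one_act _)
    dsimp only [q]
    rw [← e, a.one_act]
    exact elt_point z

/-- Since the group is constant, the g with g · y = x acts on every z, whichever fibre z lies in. -/
theorem _root_.IsCentralExtension.affine {f : E ⟶ B} (h : IsCentralExtension f)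
    {p : T.pow 3 ⟶ T.pow 1} (hp : T.IsMaltsevOp p) : Affine p f False := by
  obtain ⟨A, hA⟩ := h
  let : CartesianMonoidalCategory T.Model := .ofHasFiniteProducts
  let : BraidedCategory T.Model := .ofCartesianMonoidalCategory
  obtain ⟨a⟩ := (nonempty_torsorAction_constantGroup_iff A f).1 (isTorsorUnder_iff.1 hA).1
  choose g hg hu using fun {n : ℕ} (x y : E.carrier n) (h : homApp f x = homApp f y) =>
    a.existsUnique (point y) (point x) (by rw [point_comp, point_comp, h])
  refine affine_of_natural hp f False (fun x y z h _ => elt (a.act (g x y h) (point z))) ?_ ?_ ?_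
  · intro m n t x y z h h'
    have e1 := hu (E.app t x) (E.app t y) (homApp_app_congr h t) (freeMap t ≫ g x y h) (by
      change a.act _ _ = _
      rw [← freeMap_point, ← a.comp_act, hg, freeMap_point])
    rw [← e1, ← freeMap_point, ← a.comp_act, elt_comp]
    exact (homApp_free (M := E) _ _).symm.trans (congrArg _ (Category.comp_id _).symm)
  · intro n x y h
    rw [hg, elt_point]
  · intro n y z h
    rw [← hu y y rfl 1 (a.one_act _), a.one_act, elt_point]

end Model

end Extraction

end AlgTheory

/-! ## Difference groups -/

/-- A set partitioned into classes with a ternary operation `p(x, y, z)`, thought of as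
`(x - y) + z` and well behaved for equivalent `x` and `y`. -/
structure Herd (E : Type u) where
  /-- the equivalence relation -/
  rel : E → E → Prop
  /-- the ternary operation -/
  op : E → E → E → E
  rel_refl (x : E) : rel x x
  rel_symm {x y : E} : rel x y → rel y x
  rel_trans {x y z : E} : rel x y → rel y z → rel x z
  op_right (x y : E) : rel x y → op x y y = x
  op_left (x y : E) : op y y x = x
  rel_op {x y : E} (z : E) : rel x y → rel (op x y z) z
  assoc {x y z w : E} (v : E) : rel x y → rel z w → op (op x y z) w v = op x y (op z w v)
  comm {x y z w : E} (v : E) : rel x y → rel z w → op x y (op z w v) = op z w (op x y v)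

namespace Herd

variable {E : Type u} (H : Herd E)

lemma op_op {x y : E} (v w : E) (h : H.rel x y) : H.op (H.op x y v) v w = H.op x y w := by
  rw [H.assoc w h (H.rel_refl v), H.op_left]

/-- The group of translations `z ↦ p(x, y, z)` for equivalent `x` and `y`, containing the identity
also when `E` is empty. -/
def Diff : Type u := {φ : E → E // φ = id ∨ ∃ x y, H.rel x y ∧ φ = H.op x y}

namespace Diff

variable {H}

/-- The difference of two equivalent elements. -/
def sub (x y : E) (h : H.rel x y) : H.Diff := ⟨H.op x y, .inr ⟨x, y, h, rfl⟩⟩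

/-- Any z can serve as base point of a translation. Hence one value determines the translation, that
is, the action is free. -/
lemma val_eq_op (d : H.Diff) (z : E) : d.1 = H.op (d.1 z) z := by
  obtain ⟨φ, rfl | ⟨x, y, h, rfl⟩⟩ := d
  · exact funext fun w => (H.op_left w z).symm
  · exact funext fun w => (H.op_op z w h).symm

lemma rel_val (d : H.Diff) (z : E) : H.rel (d.1 z) z := by
  obtain ⟨φ, rfl | ⟨x, y, h, rfl⟩⟩ := d
  · exact H.rel_refl z
  · exact H.rel_op z h

lemma ext_of_apply {d d' : H.Diff} (z : E) (h : d.1 z = d'.1 z) : d = d' :=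
  Subtype.ext (by rw [d.val_eq_op z, d'.val_eq_op z, h])

lemma ext_of_forall {d d' : H.Diff} (h : ∀ z, d.1 z = d'.1 z) : d = d' :=
  Subtype.ext (funext h)

instance : Zero H.Diff := ⟨⟨id, .inl rfl⟩⟩

instance : Add H.Diff := ⟨fun d d' => ⟨fun z => d.1 (d'.1 z), by
  obtain ⟨φ', rfl | ⟨x', y', h', rfl⟩⟩ := d'
  · exact d.2
  -- The sum of d and x' − y' is d(x') − y'.
  · refine .inr ⟨d.1 x', y', H.rel_trans (d.rel_val _) h', funext fun w => ?_⟩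
    rw [d.val_eq_op x', H.assoc _ (d.rel_val _) h', ← d.val_eq_op x']⟩⟩

lemma add_val (d d' : H.Diff) (z : E) : (d + d').1 z = d.1 (d'.1 z) := rfl

lemma op_op_op {x y : E} (h : H.rel x y) (z : E) : H.op x y (H.op y x z) = z := by
  rw [← H.assoc _ h (H.rel_symm h), H.op_right _ _ h, H.op_left]

lemma op_neg {x y : E} (h : H.rel x y) (z : E) : H.op z (H.op x y z) z = H.op y x z := by
  have := H.op_op (H.op x y z) z (H.rel_symm h)
  rwa [op_op_op (H.rel_symm h)] at this

/-- The formula z − d(z) + z involves no choice of x, y with d = x − y; by `op_neg` it is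
translation by y − x. -/
instance : Neg H.Diff := ⟨fun d => ⟨fun z => H.op z (d.1 z) z, by
  obtain ⟨φ, rfl | ⟨x, y, h, rfl⟩⟩ := d
  · exact .inl (funext fun z => H.op_left z z)
  · exact .inr ⟨y, x, H.rel_symm h, funext fun z => op_neg h z⟩⟩⟩

lemma neg_val_val (d : H.Diff) (z : E) : (-d).1 (d.1 z) = z := by
  change H.op (d.1 z) (d.1 (d.1 z)) (d.1 z) = z
  obtain ⟨φ, rfl | ⟨x, y, h, rfl⟩⟩ := d
  · exact H.op_left z z
  · exact (op_neg h _).trans (op_op_op (H.rel_symm h) z)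

instance : AddCommGroup H.Diff where
  add_assoc _ _ _ := rfl
  zero_add _ := rfl
  add_zero _ := rfl
  nsmul := nsmulRec
  zsmul := zsmulRec
  neg_add_cancel d := ext_of_forall fun z => d.neg_val_val z
  add_comm d d' := by
    refine ext_of_forall fun z => ?_
    rw [add_val, add_val]
    obtain ⟨φ, rfl | ⟨x, y, h, rfl⟩⟩ := d
    · rfl
    · obtain ⟨φ', rfl | ⟨x', y', h', rfl⟩⟩ := d'
      · rfl
      · exact H.comm z h h'

lemma sub_val {x y : E} (h : H.rel x y) : (sub x y h).1 y = x := H.op_right x y h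

lemma eq_zero_of_isEmpty (hE : IsEmpty E) (d : H.Diff) : d = 0 :=
  ext_of_forall fun z => hE.elim z

end Diff

/-- Maps compatible with the structure. -/
structure Hom {E' : Type u} (H : Herd E) (H' : Herd E') where
  /-- the underlying map -/
  toFun : E → E'
  map_rel {x y : E} : H.rel x y → H'.rel (toFun x) (toFun y)
  map_op {x y : E} (z : E) : H.rel x y →
    toFun (H.op x y z) = H'.op (toFun x) (toFun y) (toFun z)

namespace Diff

variable {H} {E' E'' : Type u} {H' : Herd E'} {H'' : Herd E''}

/-- The last clause fixes d' when E is empty and compatibility with f says nothing; without it the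
chosen map need not be additive or functorial. -/
lemma exists_map (f : H.Hom H') (d : H.Diff) : ∃ d' : H'.Diff,
    (∀ z, d'.1 (f.toFun z) = f.toFun (d.1 z)) ∧ (IsEmpty E → d' = 0) := by
  obtain ⟨φ, rfl | ⟨x, y, h, rfl⟩⟩ := d
  · exact ⟨0, fun z => rfl, fun _ => rfl⟩
  · exact ⟨sub _ _ (f.map_rel h), fun z => (f.map_op z h).symm, fun hE => (hE.false x).elim⟩

/-- The map of difference groups induced by a compatible map. -/
noncomputable def mapFun (f : H.Hom H') (d : H.Diff) : H'.Diff := (exists_map f d).choose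

lemma mapFun_val (f : H.Hom H') (d : H.Diff) (z : E) :
    (mapFun f d).1 (f.toFun z) = f.toFun (d.1 z) := (exists_map f d).choose_spec.1 z

lemma mapFun_eq (f : H.Hom H') (d : H.Diff) (d' : H'.Diff)
    (h : ∀ z, d'.1 (f.toFun z) = f.toFun (d.1 z)) (h' : IsEmpty E → d' = 0) : mapFun f d = d' := by
  by_cases hE : Nonempty E
  · obtain ⟨z⟩ := hE
    exact ext_of_apply (f.toFun z) ((mapFun_val f d z).trans (h z).symm)
  · rw [not_nonempty_iff] at hE
    exact ((exists_map f d).choose_spec.2 hE).trans (h' hE).symm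

/-- The homomorphism of difference groups induced by a compatible map. -/
noncomputable def map (f : H.Hom H') : H.Diff →+ H'.Diff where
  toFun := mapFun f
  map_zero' := mapFun_eq f 0 0 (fun _ => rfl) fun _ => rfl
  map_add' d d' := mapFun_eq f _ _ (fun z => by rw [add_val, mapFun_val, mapFun_val, add_val])
    fun hE => by
      rw [eq_zero_of_isEmpty hE d, eq_zero_of_isEmpty hE d',
        mapFun_eq f 0 0 (fun _ => rfl) fun _ => rfl, add_zero]

lemma map_val (f : H.Hom H') (d : H.Diff) (z : E) :
    (map f d).1 (f.toFun z) = f.toFun (d.1 z) := mapFun_val f d z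

lemma map_eq (f : H.Hom H') (d : H.Diff) (d' : H'.Diff)
    (h : ∀ z, d'.1 (f.toFun z) = f.toFun (d.1 z)) (h' : IsEmpty E → d' = 0) : map f d = d' :=
  mapFun_eq f d d' h h'

lemma map_eq_of_nonempty (f : H.Hom H') (d : H.Diff) (d' : H'.Diff) (z : E)
    (h : d'.1 (f.toFun z) = f.toFun (d.1 z)) : map f d = d' :=
  ext_of_apply (f.toFun z) ((map_val f d z).trans h.symm)

lemma map_id (f : H.Hom H) (h : ∀ z, f.toFun z = z) (d : H.Diff) : map f d = d :=
  map_eq f d d (fun z => by rw [h, h]) fun hE => eq_zero_of_isEmpty hE d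

lemma map_map (f : H.Hom H') (g : H'.Hom H'') (k : H.Hom H'')
    (h : ∀ z, k.toFun z = g.toFun (f.toFun z)) (d : H.Diff) : map k d = map g (map f d) :=
  map_eq k d _ (fun z => by rw [h, h, map_val, map_val])
    fun hE => by rw [eq_zero_of_isEmpty hE d, map_zero, map_zero]

end Diff

end Herd

/-! ## Group objects from groups of generalized elements -/

section CommGrpOfHoms

open MonoidalCategory CartesianMonoidalCategory MonObj

variable {D : Type*} [Category* D] [CartesianMonoidalCategory D] [BraidedCategory D]

/-- An object with natural commutative group structures on its sets of generalized elements is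
a commutative group object. -/
def commGrpOfHoms (X : D) (m : ∀ Z : D, CommGroup (Z ⟶ X))
    (hm : ∀ {Z W : D} (h : W ⟶ Z) (f g : Z ⟶ X),
      h ≫ (m Z).mul f g = (m W).mul (h ≫ f) (h ≫ g)) : CommGrp D :=
  let F : Dᵒᵖ ⥤ CommGrpCat :=
    { obj Z := @CommGrpCat.of (Z.unop ⟶ X) (m _)
      map {Z W} h :=
        letI := m Z.unop
        letI := m W.unop
        CommGrpCat.ofHom (MonoidHom.mk' (fun f => h.unop ≫ f) fun f g => hm h.unop f g)
      map_id Z := by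
        ext f
        exact Category.id_comp f
      map_comp h k := by
        ext f
        exact Category.assoc k.unop h.unop f }
  let α : (F ⋙ forget _).RepresentableBy X :=
    { homEquiv := Equiv.refl _
      homEquiv_comp _ _ := rfl }
  let i : CommGrpObj X := .ofRepresentableBy X F α
  { X := X }

lemma commGrpOfHoms_mul (X : D) (m : ∀ Z : D, CommGroup (Z ⟶ X))
    (hm : ∀ {Z W : D} (h : W ⟶ Z) (f g : Z ⟶ X),
      h ≫ (m Z).mul f g = (m W).mul (h ≫ f) (h ≫ g)) {Z : D}
    (f g : Z ⟶ (commGrpOfHoms X m hm).X) : f * g = (m Z).mul f g := by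
  change lift f g ≫ (m _).mul (fst X X) (snd X X) = _
  exact (hm (lift f g) (fst X X) (snd X X)).trans
    (congrArg₂ (m Z).mul (lift_fst f g) (lift_snd f g))

lemma commGrpOfHoms_one (X : D) (m : ∀ Z : D, CommGroup (Z ⟶ X))
    (hm : ∀ {Z W : D} (h : W ⟶ Z) (f g : Z ⟶ X),
      h ≫ (m Z).mul f g = (m W).mul (h ≫ f) (h ≫ g)) {Z : D} :
    (1 : Z ⟶ (commGrpOfHoms X m hm).X) = (m Z).one := by
  have h := commGrpOfHoms_mul X m hm (Z := Z) 1 1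
  rw [_root_.mul_one] at h
  have key {G : Type _} [Group G] {a : G} (ha : a = a * a) : a = 1 := by simpa using ha
  exact @key _ (m Z).toGroup _ h

end CommGrpOfHoms

/-! ### Herds of affine homomorphisms, and central extensions built from them -/

namespace AlgTheory

namespace Model

variable {T : AlgTheory.{u}} {E B : T.Model} {p : T.pow 3 ⟶ T.pow 1} {f : E ⟶ B}

lemma homApp_tri_left (hp : T.IsMaltsevOp p) {n : ℕ} {x y : E.carrier n} (z : E.carrier n)
    (h : homApp f x = homApp f y) : homApp f (E.tri p x y z) = homApp f z := by
  rw [homApp_tri, h, tri_left hp]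

/-- The fibres of a homomorphism as herds. -/
noncomputable def Affine.fiberHerd (ha : Affine p f True) (hp : T.IsMaltsevOp p) {n : ℕ}
    (b : B.carrier n) : Herd {e : E.carrier n // homApp f e = b} where
  rel _ _ := True
  op x y z := ⟨E.tri p x.1 y.1 z.1, by rw [homApp_tri_left hp _ (x.2.trans y.2.symm), z.2]⟩
  rel_refl _ := trivial
  rel_symm _ := trivial
  rel_trans _ _ := trivial
  op_right x y _ := Subtype.ext (tri_right hp x.1 y.1)
  op_left x y := Subtype.ext (tri_left hp x.1 y.1)
  rel_op _ _ := trivial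
  assoc {x y z w} w' _ _ := Subtype.ext (ha.tri_assoc hp (x.2.trans y.2.symm)
    (fun _ => y.2.trans z.2.symm) (fun _ => z.2.trans w.2.symm) fun _ => w.2.trans w'.2.symm)
  comm {x y z w} w' _ _ := Subtype.ext (ha.tri_comm hp (x.2.trans y.2.symm)
    (fun _ => y.2.trans z.2.symm) (fun _ => z.2.trans w.2.symm) fun _ => w.2.trans w'.2.symm)

/-- The elements of the source of a central extension as a herd. -/
noncomputable def Affine.totalHerd (ha : Affine p f False) (hp : T.IsMaltsevOp p) (n : ℕ) :
    Herd (E.carrier n) where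
  rel x y := homApp f x = homApp f y
  op := E.tri p
  rel_refl _ := rfl
  rel_symm h := h.symm
  rel_trans h h' := h.trans h'
  op_right x y _ := tri_right hp x y
  op_left x y := tri_left hp x y
  rel_op z h := homApp_tri_left hp z h
  assoc _ h _ := ha.tri_assoc hp h False.elim False.elim False.elim
  comm _ h _ := ha.tri_comm hp h False.elim False.elim False.elim

section Central

variable (ha : Affine p f False) (hp : T.IsMaltsevOp p)

/-- The action of a morphism of the theory, as a morphism of herds. -/
noncomputable def Affine.totalApp {m n : ℕ} (t : T.pow m ⟶ T.pow n) :
    (ha.totalHerd hp m).Hom (ha.totalHerd hp n) where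
  toFun := E.app t
  map_rel h := homApp_app_congr h t
  map_op z h := ha t _ _ z h False.elim

/-- The model of differences of elements with equal images. -/
noncomputable def Affine.diffModel : T.Model :=
  ofApp (fun n => (ha.totalHerd hp n).Diff) (fun t => Herd.Diff.map (ha.totalApp hp t))
    (Herd.Diff.map_id _ E.app_id)
    (fun s t => Herd.Diff.map_map (ha.totalApp hp s) (ha.totalApp hp t) (ha.totalApp hp (s ≫ t))
      (E.app_comp s t))
    fun n => by
      by_cases hE : Nonempty (E.carrier n)
      · obtain ⟨z⟩ := hE
        constructor
        · intro d d' h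
          refine Herd.Diff.ext_of_apply z (elt_ext fun i => ?_)
          have h1 := Herd.Diff.map_val (ha.totalApp hp (T.proj i)) d z
          have h2 := Herd.Diff.map_val (ha.totalApp hp (T.proj i)) d' z
          exact h1.symm.trans ((congrArg (fun d => d.1 (E.app (T.proj i) z)) (congrFun h i)).trans
            h2)
        · intro d
          -- Translating the coordinates of z by the given d i produces y; the required element is y
          -- − z.
          let y := E.tuple fun i => (d i).1 (E.app (T.proj i) z)
          have hy : homApp f y = homApp f z := by
            rw [← E.tuple_app_proj z]
            refine homApp_tuple_congr fun i => ?_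
            exact (d i).rel_val _
          refine ⟨.sub y z hy, funext fun i => Herd.Diff.map_eq_of_nonempty _ _ _ z ?_⟩
          exact (E.app_proj_tuple _ i).symm.trans
            (congrArg (E.app (T.proj i)) (Herd.Diff.sub_val (H := ha.totalHerd hp n) hy).symm)
      · rw [not_nonempty_iff] at hE
        -- A constant tuple would be an element of E(X^n). So E(X) is empty as well and has only the
        -- zero difference.
        have h1 : n ≠ 0 → IsEmpty (E.carrier 1) := fun _ =>
          ⟨fun e => hE.false (E.tuple fun _ => e)⟩
        constructor
        · intro d d' _
          rw [d.eq_zero_of_isEmpty hE, d'.eq_zero_of_isEmpty hE]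
        · intro d
          refine ⟨0, funext fun i => ?_⟩
          change Herd.Diff.map _ 0 = _
          rw [(d i).eq_zero_of_isEmpty (h1 (by have := i.2; omega)),
            map_zero]

/-- The difference represented by an element of `diffModel`. -/
def Affine.diff {n : ℕ} (d : (ha.diffModel hp).carrier n) : (ha.totalHerd hp n).Diff := d

/-- Differences may be added, negated, ... along homomorphisms to `diffModel`. -/
noncomputable def Affine.mkDiffHom {Z : T.Model} (d : ∀ n, Z.carrier n → (ha.totalHerd hp n).Diff)
    (hd : ∀ ⦃m n⦄ (t : T.pow m ⟶ T.pow n) (z : Z.carrier m),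
      d n (Z.app t z) = Herd.Diff.map (ha.totalApp hp t) (d m z)) : Z ⟶ ha.diffModel hp :=
  mkHom (N := ha.diffModel hp) d fun t z => hd t z

lemma Affine.diff_homApp_app {Z : T.Model} (g : Z ⟶ ha.diffModel hp) {m n : ℕ}
    (t : T.pow m ⟶ T.pow n) (z : Z.carrier m) : ha.diff hp (homApp g (Z.app t z)) =
      Herd.Diff.map (ha.totalApp hp t) (ha.diff hp (homApp g z)) := by
  rw [homApp_app]; rfl

/-- The pointwise group structure on homomorphisms to `diffModel`. -/
@[reducible]
noncomputable def Affine.diffHomGroup (Z : T.Model) : CommGroup (Z ⟶ ha.diffModel hp) where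
  mul g g' := ha.mkDiffHom hp (fun _ z => ha.diff hp (homApp g z) + ha.diff hp (homApp g' z))
    fun m n t z => by rw [diff_homApp_app, diff_homApp_app, map_add]
  one := ha.mkDiffHom hp (fun _ _ => 0) fun m n t z => (map_zero _).symm
  inv g := ha.mkDiffHom hp (fun _ z => - ha.diff hp (homApp g z))
    fun m n t z => by rw [diff_homApp_app, map_neg]
  mul_assoc _ _ _ := hom_ext fun _ _ => add_assoc (G := Herd.Diff _) _ _ _
  one_mul _ := hom_ext fun _ _ => zero_add (M := Herd.Diff _) _
  mul_one _ := hom_ext fun _ _ => add_zero (M := Herd.Diff _) _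
  inv_mul_cancel _ := hom_ext fun _ _ => neg_add_cancel (G := Herd.Diff _) _
  mul_comm _ _ := hom_ext fun _ _ => add_comm (G := Herd.Diff _) _ _

/-- The action of differences on elements. -/
noncomputable def Affine.diffAct {Z : T.Model} (g : Z ⟶ ha.diffModel hp) (t : Z ⟶ E) : Z ⟶ E :=
  mkHom (fun n z => (ha.diff hp (homApp g z)).1 (homApp t z)) fun {m n} s z => by
    rw [diff_homApp_app, homApp_app]
    exact Herd.Diff.map_val (ha.totalApp hp s) _ _

-- Centrality lets a difference act on all of E and not only on its own fibre, so a single model of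
-- differences serves as the constant group.
attribute [local instance] Over.cartesianMonoidalCategory Over.braidedCategory in
open MonoidalCategory CartesianMonoidalCategory MonObj in
lemma Affine.isCentralExtension (ha : Affine p f False) (hp : T.IsMaltsevOp p)
    (hf : ∀ n : ℕ, Function.Surjective (homApp f (n := n))) :
    IsCentralExtension f := by
  let : CartesianMonoidalCategory T.Model := .ofHasFiniteProducts
  let : BraidedCategory T.Model := .ofCartesianMonoidalCategory
  let A : CommGrp T.Model := commGrpOfHoms (ha.diffModel hp) (ha.diffHomGroup hp) fun h g g' => rfl
  refine ⟨A, isTorsorUnder_iff.2 ⟨(nonempty_torsorAction_constantGroup_iff A f).2 ⟨?_⟩,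
    isColimit_of_surjective f hf⟩⟩
  exact
    { act g t := ha.diffAct hp g t
      comp_act h g t := rfl
      one_act t := congrArg (fun g => ha.diffAct hp g t) (commGrpOfHoms_one _ _ _)
      mul_act g g' t := congrArg (fun g => ha.diffAct hp g t) (commGrpOfHoms_mul _ _ _ g g')
      act_comp g t := hom_ext fun n z => Herd.Diff.rel_val (ha.diff hp (homApp g z)) (homApp t z)
      existsUnique {Z} t t' h := by
        have h' {n : ℕ} (z : Z.carrier n) :
            (ha.totalHerd hp n).rel (homApp t' z) (homApp t z) :=
          congrArg (fun k => homApp k z) h.symm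
        refine ⟨ha.mkDiffHom hp (fun n z => .sub (homApp t' z) (homApp t z) (h' z)) ?_, ?_, ?_⟩
        · intro m n s z
          refine (Herd.Diff.map_eq_of_nonempty _ _ _ (homApp t z) ?_).symm
          refine Eq.trans ?_ (congrArg (E.app s) (Herd.Diff.sub_val (h' z)).symm)
          change (Herd.Diff.sub _ _ _).1 (E.app s (homApp t z)) = _
          rw [← homApp_app, ← homApp_app]
          exact Herd.Diff.sub_val (h' (Z.app s z))
        · exact hom_ext fun n z => Herd.Diff.sub_val (h' z)
        · intro g hg
          refine hom_ext fun n z => ?_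
          refine Herd.Diff.ext_of_apply (H := ha.totalHerd hp n) (homApp t z) ?_
          exact (congrArg (fun k => homApp k z) hg).trans (Herd.Diff.sub_val (h' z)).symm }

end Central

end Model

/-! ### Abelian extensions from affineness on the fibres -/

namespace Model

section Abelian

variable {T : AlgTheory.{u}} {E B : T.Model} {p : T.pow 3 ⟶ T.pow 1} {f : E ⟶ B}
  (ha : Affine p f True) (hp : T.IsMaltsevOp p)

/-- The action of a morphism of the theory on fibres, as a morphism of herds. -/
noncomputable def Affine.fiberApp {m n : ℕ} (t : T.pow m ⟶ T.pow n) (b : B.carrier m) :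
    (ha.fiberHerd hp b).Hom (ha.fiberHerd hp (B.app t b)) where
  toFun e := ⟨E.app t e.1, by rw [homApp_app, e.2]⟩
  map_rel _ := trivial
  map_op {x y} z _ := Subtype.ext (ha t _ _ _ (x.2.trans y.2.symm) fun _ => y.2.trans z.2.symm)

/-- Elements of `B` together with a difference in the fibre over them. -/
abbrev Affine.FiberDiff (n : ℕ) : Type u := Σ b : B.carrier n, (ha.fiberHerd hp b).Diff

namespace Affine.FiberDiff

variable {ha hp} {n : ℕ}

/-- The action of differences on elements of the fibre. -/
def act (g : ha.FiberDiff hp n) (e : E.carrier n) (h : homApp f e = g.1) : E.carrier n :=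
  (g.2.1 ⟨e, h⟩).1

lemma homApp_act (g : ha.FiberDiff hp n) (e : E.carrier n) (h : homApp f e = g.1) :
    homApp f (act g e h) = g.1 := (g.2.1 ⟨e, h⟩).2

lemma act_congr {g g' : ha.FiberDiff hp n} {e e' : E.carrier n} (h : homApp f e = g.1)
    (hg : g = g') (he : e = e') :
    act g e h = act g' e' (by rw [← he, h, hg]) := by
  subst hg he
  rfl

/-- Equality of differences whose base points agree only propositionally is thereby tested in E,
without transport between groups. -/
lemma ext_act {g g' : ha.FiberDiff hp n} (e : E.carrier n) (h : homApp f e = g.1)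
    (h' : homApp f e = g'.1) (hh : act g e h = act g' e h') : g = g' := by
  obtain ⟨b, d⟩ := g
  obtain ⟨b', d'⟩ := g'
  obtain rfl : homApp f e = b := h
  obtain rfl : homApp f e = b' := h'
  exact congrArg (Sigma.mk _) (Herd.Diff.ext_of_apply ⟨e, rfl⟩ (Subtype.ext hh))

/-- The action of the theory on differences. -/
noncomputable def app {m : ℕ} (t : T.pow m ⟶ T.pow n) (g : ha.FiberDiff hp m) :
    ha.FiberDiff hp n :=
  ⟨B.app t g.1, Herd.Diff.map (ha.fiberApp hp t g.1) g.2⟩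

lemma act_app {m : ℕ} (t : T.pow m ⟶ T.pow n) (g : ha.FiberDiff hp m) (e : E.carrier m)
    (h : homApp f e = g.1) :
    act (app t g) (E.app t e) (by rw [homApp_app, h]; rfl) = E.app t (act g e h) :=
  congrArg Subtype.val (Herd.Diff.map_val (ha.fiberApp hp t g.1) g.2 ⟨e, h⟩)

/-- The difference of two elements. -/
noncomputable def sub (y e : E.carrier n) (h : homApp f y = homApp f e) : ha.FiberDiff hp n :=
  ⟨homApp f e, Herd.Diff.sub (H := ha.fiberHerd hp (homApp f e)) ⟨y, h⟩ ⟨e, rfl⟩ trivial⟩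

lemma act_sub (y e : E.carrier n) (h : homApp f y = homApp f e) :
    act (sub (ha := ha) (hp := hp) y e h) e rfl = y :=
  congrArg Subtype.val (Herd.Diff.sub_val (H := ha.fiberHerd hp (homApp f e)) (x := ⟨y, h⟩)
    (y := ⟨e, rfl⟩) trivial)

/-- The sum of two differences over the same element. -/
noncomputable def add (g g' : ha.FiberDiff hp n) (h : g.1 = g'.1) : ha.FiberDiff hp n :=
  ⟨g.1, g.2 + h ▸ g'.2⟩

lemma act_add (g g' : ha.FiberDiff hp n) (h : g.1 = g'.1) (e : E.carrier n)
    (he : homApp f e = g.1) :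
    act (add g g' h) e he = act g (act g' e (he.trans h)) ((homApp_act _ _ _).trans h.symm) := by
  obtain ⟨b, d⟩ := g
  obtain ⟨b', d'⟩ := g'
  obtain rfl : b = b' := h
  rfl

lemma add_app {m : ℕ} (t : T.pow m ⟶ T.pow n) (g g' : ha.FiberDiff hp m) (h : g.1 = g'.1) :
    app t (add g g' h) = add (app t g) (app t g') (congrArg (B.app t) h) := by
  obtain ⟨b, d⟩ := g
  obtain ⟨b', d'⟩ := g'
  obtain rfl : b = b' := h
  exact congrArg (Sigma.mk _) (map_add _ _ _)

lemma add_assoc (g g' g'' : ha.FiberDiff hp n) (h : g.1 = g'.1) (h' : g'.1 = g''.1) :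
    add (add g g' h) g'' (h.trans h') = add g (add g' g'' h') h := by
  obtain ⟨b, d⟩ := g
  obtain ⟨b', d'⟩ := g'
  obtain ⟨b'', d''⟩ := g''
  obtain rfl : b = b' := h
  obtain rfl : b = b'' := h'
  exact congrArg (Sigma.mk _) (_root_.add_assoc _ _ _)

lemma add_comm (g g' : ha.FiberDiff hp n) (h : g.1 = g'.1) : add g g' h = add g' g h.symm := by
  obtain ⟨b, d⟩ := g
  obtain ⟨b', d'⟩ := g'
  obtain rfl : b = b' := h
  exact congrArg (Sigma.mk _) (_root_.add_comm _ _)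

lemma zero_add (b : B.carrier n) (g : ha.FiberDiff hp n) (h : b = g.1) : add ⟨b, 0⟩ g h = g := by
  obtain ⟨b', d'⟩ := g
  obtain rfl : b = b' := h
  exact congrArg (Sigma.mk _) (_root_.zero_add _)

lemma neg_add (b : B.carrier n) (g : ha.FiberDiff hp n) (h : b = g.1) :
    add ⟨g.1, -g.2⟩ g rfl = ⟨b, 0⟩ := by
  obtain ⟨b', d'⟩ := g
  obtain rfl : b = b' := h
  exact congrArg (Sigma.mk _) (_root_.neg_add_cancel _)

end Affine.FiberDiff

open Affine.FiberDiff

/-- The model of differences in the fibres. -/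
noncomputable def Affine.fiberDiffModel
    (hf : ∀ n : ℕ, Function.Surjective (homApp f (n := n))) : T.Model :=
  ofApp (fun n => ha.FiberDiff hp n) FiberDiff.app
    (fun {n} g => by
      -- Surjectivity provides an element of the fibre on which both sides can be evaluated; the
      -- composition law is treated likewise.
      obtain ⟨e, he⟩ := hf n g.1
      have he' : homApp f (E.app (𝟙 _) e) = B.app (𝟙 _) g.1 := by rw [homApp_app, he]
      refine ext_act (E.app (𝟙 _) e) he' (he'.trans (B.app_id _)) ?_
      rw [act_app _ _ _ he, app_id]
      exact act_congr _ rfl (E.app_id e).symm)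
    (fun {l m n} s t g => by
      obtain ⟨e, he⟩ := hf l g.1
      have he' : homApp f (E.app s e) = B.app s g.1 := by rw [homApp_app, he]
      have he'' : homApp f (E.app t (E.app s e)) = B.app t (B.app s g.1) := by rw [homApp_app, he']
      refine ext_act (E.app t (E.app s e)) (he''.trans (B.app_comp s t _).symm) he'' ?_
      refine Eq.trans ?_ (act_app t (FiberDiff.app s g) (E.app s e) he').symm
      rw [act_app s g e he]
      exact (act_congr _ rfl (E.app_comp s t e).symm).trans
        ((act_app (s ≫ t) g e he).trans (E.app_comp s t _)))
    fun n => by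
      constructor
      · intro g g' h
        have hb : g.1 = g'.1 := elt_ext fun i => congrArg Sigma.fst (congrFun h i)
        obtain ⟨e, he⟩ := hf n g.1
        refine ext_act e he (he.trans hb) (elt_ext fun i => ?_)
        rw [← act_app, ← act_app]
        exact act_congr _ (congrFun h i) rfl
      · intro g
        obtain ⟨e, he⟩ := hf n (B.tuple fun i => (g i).1)
        have he' (i : Fin n) : homApp f (E.app (T.proj i) e) = (g i).1 := by
          rw [homApp_app, he, app_proj_tuple]
        let y := E.tuple fun i => FiberDiff.act (g i) (E.app (T.proj i) e) (he' i)
        have hy : homApp f y = homApp f e := by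
          rw [homApp_tuple, he]
          exact congrArg B.tuple (funext fun i => homApp_act _ _ _)
        refine ⟨.sub y e hy, funext fun i => ?_⟩
        refine ext_act (E.app (T.proj i) e) (homApp_app _ _ _) (he' i) ?_
        rw [act_app (T.proj i) _ e rfl, act_sub, app_proj_tuple]

variable (hf : ∀ n : ℕ, Function.Surjective (homApp f (n := n)))

/-- The projection of the model of differences to the base. -/
noncomputable def Affine.fiberDiffπ : ha.fiberDiffModel hp hf ⟶ B :=
  mkHom (M := ha.fiberDiffModel hp hf) (fun _ g => Sigma.fst g) fun _ _ => rfl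

/-- A morphism over `B` to the model of differences. -/
noncomputable def Affine.mkFiberDiffHom {Z : Over B} (d : ∀ n, Z.left.carrier n → ha.FiberDiff hp n)
    (hd : ∀ ⦃m n⦄ (t : T.pow m ⟶ T.pow n) (z : Z.left.carrier m),
      d n (Z.left.app t z) = FiberDiff.app t (d m z))
    (h : ∀ n (z : Z.left.carrier n), (d n z).1 = homApp Z.hom z) :
    Z ⟶ Over.mk (ha.fiberDiffπ hp hf) :=
  Over.homMk (mkHom (N := ha.fiberDiffModel hp hf) d fun t z => hd t z) (hom_ext h)

/-- The value of a morphism to the model of differences. -/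
noncomputable def Affine.fiberDiffVal {Z : Over B} (g : Z ⟶ Over.mk (ha.fiberDiffπ hp hf)) {n : ℕ}
    (z : Z.left.carrier n) : ha.FiberDiff hp n :=
  homApp (N := ha.fiberDiffModel hp hf) g.left z

lemma Affine.fiberDiffVal_app {Z : Over B} (g : Z ⟶ Over.mk (ha.fiberDiffπ hp hf)) {m n : ℕ}
    (t : T.pow m ⟶ T.pow n) (z : Z.left.carrier m) :
    ha.fiberDiffVal hp hf g (Z.left.app t z) = FiberDiff.app t (ha.fiberDiffVal hp hf g z) :=
  homApp_app (N := ha.fiberDiffModel hp hf) g.left t z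

lemma Affine.fiberDiffVal_fst {Z : Over B} (g : Z ⟶ Over.mk (ha.fiberDiffπ hp hf)) {n : ℕ}
    (z : Z.left.carrier n) : (ha.fiberDiffVal hp hf g z).1 = homApp Z.hom z :=
  congrArg (fun k => homApp k z) (Over.w g)

lemma Affine.fiberDiffHom_ext {Z : Over B} {g g' : Z ⟶ Over.mk (ha.fiberDiffπ hp hf)}
    (h : ∀ n (z : Z.left.carrier n), ha.fiberDiffVal hp hf g z = ha.fiberDiffVal hp hf g' z) :
    g = g' := by
  ext1
  exact hom_ext h

/-- The pointwise sum of morphisms to the model of differences. -/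
noncomputable def Affine.fiberDiffMul {Z : Over B} (g g' : Z ⟶ Over.mk (ha.fiberDiffπ hp hf)) :
    Z ⟶ Over.mk (ha.fiberDiffπ hp hf) :=
  ha.mkFiberDiffHom hp hf
    (fun _ z => (ha.fiberDiffVal hp hf g z).add (ha.fiberDiffVal hp hf g' z)
      ((ha.fiberDiffVal_fst hp hf g z).trans (ha.fiberDiffVal_fst hp hf g' z).symm))
    (fun m n t z => by
      rw [add_app]
      congr 1 <;> exact ha.fiberDiffVal_app hp hf _ t z)
    fun _ z => ha.fiberDiffVal_fst hp hf g z

lemma Affine.fiberDiffVal_mul {Z : Over B} (g g' : Z ⟶ Over.mk (ha.fiberDiffπ hp hf)) {n : ℕ}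
    (z : Z.left.carrier n) : ha.fiberDiffVal hp hf (ha.fiberDiffMul hp hf g g') z =
      (ha.fiberDiffVal hp hf g z).add (ha.fiberDiffVal hp hf g' z)
        ((ha.fiberDiffVal_fst hp hf g z).trans (ha.fiberDiffVal_fst hp hf g' z).symm) := rfl

/-- The zero morphism to the model of differences. -/
noncomputable def Affine.fiberDiffOne (Z : Over B) : Z ⟶ Over.mk (ha.fiberDiffπ hp hf) :=
  ha.mkFiberDiffHom hp hf (fun _ z => ⟨homApp Z.hom z, 0⟩)
    (fun m n t z => by
      rw [homApp_app]
      exact congrArg (Sigma.mk _) (map_zero _).symm)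
    fun _ _ => rfl

/-- The pointwise negative of a morphism to the model of differences. -/
noncomputable def Affine.fiberDiffInv {Z : Over B} (g : Z ⟶ Over.mk (ha.fiberDiffπ hp hf)) :
    Z ⟶ Over.mk (ha.fiberDiffπ hp hf) :=
  ha.mkFiberDiffHom hp hf
    (fun _ z => ⟨(ha.fiberDiffVal hp hf g z).1, -(ha.fiberDiffVal hp hf g z).2⟩)
    (fun m n t z => by
      rw [ha.fiberDiffVal_app]
      exact congrArg (Sigma.mk _) (map_neg _ _).symm)
    fun _ z => ha.fiberDiffVal_fst hp hf g z

lemma Affine.fiberDiffMul_comm {Z : Over B} (g g' : Z ⟶ Over.mk (ha.fiberDiffπ hp hf)) :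
    ha.fiberDiffMul hp hf g g' = ha.fiberDiffMul hp hf g' g :=
  ha.fiberDiffHom_ext hp hf fun _ _ => by
    rw [fiberDiffVal_mul, fiberDiffVal_mul, FiberDiff.add_comm]

lemma Affine.fiberDiffOne_mul {Z : Over B} (g : Z ⟶ Over.mk (ha.fiberDiffπ hp hf)) :
    ha.fiberDiffMul hp hf (ha.fiberDiffOne hp hf Z) g = g :=
  ha.fiberDiffHom_ext hp hf fun _ z => FiberDiff.zero_add (homApp Z.hom z)
    (ha.fiberDiffVal hp hf g z) (ha.fiberDiffVal_fst hp hf g z).symm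

/-- The pointwise group structure on morphisms to the model of differences. -/
@[reducible]
noncomputable def Affine.fiberDiffHomGroup (Z : Over B) :
    CommGroup (Z ⟶ Over.mk (ha.fiberDiffπ hp hf)) where
  mul := ha.fiberDiffMul hp hf
  one := ha.fiberDiffOne hp hf Z
  inv := ha.fiberDiffInv hp hf
  mul_assoc g g' g'' := ha.fiberDiffHom_ext hp hf fun _ z => FiberDiff.add_assoc
    (ha.fiberDiffVal hp hf g z) (ha.fiberDiffVal hp hf g' z) (ha.fiberDiffVal hp hf g'' z)
    ((ha.fiberDiffVal_fst hp hf g z).trans (ha.fiberDiffVal_fst hp hf g' z).symm)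
    ((ha.fiberDiffVal_fst hp hf g' z).trans (ha.fiberDiffVal_fst hp hf g'' z).symm)
  one_mul := ha.fiberDiffOne_mul hp hf
  mul_one g := (ha.fiberDiffMul_comm hp hf _ _).trans (ha.fiberDiffOne_mul hp hf g)
  inv_mul_cancel g := ha.fiberDiffHom_ext hp hf fun _ z => FiberDiff.neg_add (homApp Z.hom z)
    (ha.fiberDiffVal hp hf g z) (ha.fiberDiffVal_fst hp hf g z).symm
  mul_comm := ha.fiberDiffMul_comm hp hf

/-- The action of differences on elements. -/
noncomputable def Affine.fiberDiffAct {Z : Over B} (g : Z ⟶ Over.mk (ha.fiberDiffπ hp hf))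
    (t : Z ⟶ Over.mk f) : Z ⟶ Over.mk f :=
  have h {n : ℕ} (z : Z.left.carrier n) : homApp f (homApp (N := E) t.left z) =
      (ha.fiberDiffVal hp hf g z).1 :=
    (congrArg (fun k => homApp k z) (Over.w t)).trans (ha.fiberDiffVal_fst hp hf g z).symm
  Over.homMk
    (mkHom (N := E) (fun _ z => (ha.fiberDiffVal hp hf g z).act (homApp t.left z) (h z))
      fun s z => (act_congr _ (ha.fiberDiffVal_app hp hf g s z) (homApp_app t.left s z)).trans
        (act_app s _ _ (h z)))
    (hom_ext fun _ z => (homApp_act _ _ _).trans (ha.fiberDiffVal_fst hp hf g z))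

attribute [local instance] Over.cartesianMonoidalCategory Over.braidedCategory in
open MonoidalCategory CartesianMonoidalCategory MonObj in
lemma Affine.isAbelianExtension (ha : Affine p f True) (hp : T.IsMaltsevOp p)
    (hf : ∀ n : ℕ, Function.Surjective (homApp f (n := n))) : IsAbelianExtension f := by
  let G : CommGrp (Over B) := commGrpOfHoms (Over.mk (ha.fiberDiffπ hp hf))
    (ha.fiberDiffHomGroup hp hf) fun h g g' => rfl
  refine ⟨G, isTorsorUnder_iff.2 ⟨⟨?_⟩, isColimit_of_surjective f hf⟩⟩
  exact
    { act g t := ha.fiberDiffAct hp hf g t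
      comp_act h g t := rfl
      one_act t := congrArg (fun g => ha.fiberDiffAct hp hf g t) (commGrpOfHoms_one _ _ _)
      mul_act g g' t := (congrArg (fun g => ha.fiberDiffAct hp hf g t)
        (commGrpOfHoms_mul _ _ _ g g')).trans (by
          ext1
          exact hom_ext fun n z => act_add _ _ ((ha.fiberDiffVal_fst hp hf g z).trans
            (ha.fiberDiffVal_fst hp hf g' z).symm) _ _)
      existsUnique {Z} t t' := by
        have h (t : Z ⟶ Over.mk f) {n : ℕ} (z : Z.left.carrier n) :
            homApp (N := B) f (homApp (N := E) t.left z) = homApp Z.hom z :=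
          congrArg (fun k => homApp k z) (Over.w t)
        have hs (t : Z ⟶ Over.mk f) {m n : ℕ} (s : T.pow m ⟶ T.pow n) (z : Z.left.carrier m) :
            homApp (N := E) t.left (Z.left.app s z) = E.app s (homApp t.left z) :=
          homApp_app _ _ _
        have hh {n : ℕ} (z : Z.left.carrier n) := (h t' z).trans (h t z).symm
        refine ⟨ha.mkFiberDiffHom hp hf (fun n z => .sub (homApp t'.left z) (homApp t.left z)
          (hh z)) ?_ (fun n z => h t z), ?_, ?_⟩
        · intro m n s z
          refine ext_act (homApp (N := E) t.left (Z.left.app s z)) rfl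
            ((congrArg (homApp (N := B) f) (hs t s z)).trans (homApp_app _ _ _)) ?_
          rw [act_sub, hs]
          refine (congrArg (E.app s) (act_sub (ha := ha) (hp := hp) _ _ (hh z)).symm).trans ?_
          exact (act_app s _ _ rfl).symm.trans (act_congr _ rfl (hs t s z).symm)
        · ext1
          exact hom_ext fun n z => act_sub _ _ _
        · intro g hg
          refine ha.fiberDiffHom_ext hp hf fun n z => ?_
          refine ext_act (homApp (N := E) t.left z)
            ((h t z).trans (ha.fiberDiffVal_fst hp hf g z).symm) rfl ?_
          exact (congrArg (fun k => homApp (Over.Hom.left k) z) hg).trans (act_sub _ _ _).symm }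

end Abelian

end Model

/-! ### The Maltsev operation on morphisms of a theory -/

open Model

/-- A ternary operation applied to tuples of operations. -/
noncomputable def triHom {T : AlgTheory.{u}} (p : T.pow 3 ⟶ T.pow 1) {j n : ℕ}
    (a b c : T.pow j ⟶ T.pow n) : T.pow j ⟶ T.pow n :=
  (T.free j).tri p (n := n) a b c

lemma triHom_right {T : AlgTheory.{u}} {p : T.pow 3 ⟶ T.pow 1} (hp : T.IsMaltsevOp p) {j n : ℕ}
    (a b : T.pow j ⟶ T.pow n) : triHom p a b b = a := tri_right (M := T.free j) (n := n) hp a b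

lemma triHom_left {T : AlgTheory.{u}} {p : T.pow 3 ⟶ T.pow 1} (hp : T.IsMaltsevOp p) {j n : ℕ}
    (a b : T.pow j ⟶ T.pow n) : triHom p b b a = a := tri_left (M := T.free j) (n := n) hp a b

lemma app_triHom {T : AlgTheory.{u}} (M : T.Model) (p : T.pow 3 ⟶ T.pow 1) {j n : ℕ}
    (a b c : T.pow j ⟶ T.pow n) (e : M.carrier j) :
    M.app (triHom p a b c) e = M.tri p (M.app a e) (M.app b e) (M.app c e) :=
  homApp_tri (point e) (show (T.free j).carrier n from a) b c

lemma comp_triHom {T : AlgTheory.{u}} (p : T.pow 3 ⟶ T.pow 1) {i j n : ℕ} (t : T.pow i ⟶ T.pow j)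
    (a b c : T.pow j ⟶ T.pow n) : t ≫ triHom p a b c = triHom p (t ≫ a) (t ≫ b) (t ≫ c) :=
  app_triHom (T.free i) p a b c t

/-- The morphism of the theory corresponding to a homomorphism of free models. -/
def homOfFree {T : AlgTheory.{u}} {n k : ℕ} (f : T.free n ⟶ T.free k) : T.pow k ⟶ T.pow n := elt f

lemma mapCarrier_free {T : AlgTheory.{u}} {n k : ℕ} (f : T.free n ⟶ T.free k)
    (x : T.pow n ⟶ T.pow 1) : mapCarrier f x = homOfFree f ≫ x := homApp_free f x

lemma homOfFree_freeMap {T : AlgTheory.{u}} {n k : ℕ} (u : T.pow k ⟶ T.pow n) :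
    homOfFree (freeMap u) = u := elt_point (M := T.free k) (n := n) u

/-! ### The unit on free models, and ♢ as an identity between morphisms of T' -/

section Unit

variable {T' T : AlgTheory.{u}} (P : Mor T' T)

/-- A morphism of theories that is surjective on morphisms. -/
def Mor.Full : Prop := ∀ m n : ℕ, Function.Surjective (P.map (m := m) (n := n))

/-- The homomorphism `T'(n) ⟶ T(n)` given by a morphism of theories. -/
def Mor.freeHom (n : ℕ) : T'.free n ⟶ P.restrict.obj (T.free n) :=
  mkHom (M := T'.free n) (N := P.restrict.obj (T.free n))
    (fun k (s : T'.pow n ⟶ T'.pow k) => (P.map s : T.pow n ⟶ T.pow k))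
    fun t s => P.map_comp s t

lemma Mor.map_triHom (p : T'.pow 3 ⟶ T'.pow 1) {m n : ℕ} {a b c a' b' c' : T'.pow m ⟶ T'.pow n}
    (ha : P.map a = P.map a') (hb : P.map b = P.map b') (hc : P.map c = P.map c') :
    P.map (triHom p a b c) = P.map (triHom p a' b' c') := by
  -- F is p acting on the free T-model through P; `freeHom`, being a homomorphism, commutes with p.
  obtain ⟨F, hF⟩ : ∃ F : (T.pow m ⟶ T.pow n) → (T.pow m ⟶ T.pow n) → (T.pow m ⟶ T.pow n) →
      (T.pow m ⟶ T.pow n), ∀ a b c, P.map (triHom p a b c) = F (P.map a) (P.map b) (P.map c) :=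
    ⟨fun x y z => (P.restrict.obj (T.free m)).tri p (n := n) x y z, fun a b c =>
      homApp_tri (P.freeHom m) (show (T'.free m).carrier n from a) b c⟩
  rw [hF, hF, ha, hb, hc]

/-- The homomorphism out of the left adjoint corresponding to a homomorphism. -/
noncomputable def Mor.desc {M : T'.Model} {N : T.Model} (h : M ⟶ P.restrict.obj N) :
    P.extend.obj M ⟶ N :=
  ((Adjunction.ofIsRightAdjoint P.restrict).homEquiv M N).symm h

lemma Mor.unit_desc {M : T'.Model} {N : T.Model} (h : M ⟶ P.restrict.obj N) :
    P.unit M ≫ P.restrict.map (P.desc h) = h :=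
  ((Adjunction.ofIsRightAdjoint P.restrict).homEquiv_unit _ _ _).symm.trans
    (Equiv.apply_symm_apply _ _)

lemma Mor.homApp_desc {M : T'.Model} {N : T.Model} (h : M ⟶ P.restrict.obj N) {n : ℕ}
    (x : M.carrier n) :
    homApp (M := P.extend.obj M) (N := N) (n := n) (P.desc h) (homApp (P.unit M) x) =
      homApp h x :=
  congrArg (fun k => homApp k x) (P.unit_desc h)

lemma Mor.extend_hom_ext {M : T'.Model} {N : T.Model} {f g : P.extend.obj M ⟶ N}
    (h : P.unit M ≫ P.restrict.map f = P.unit M ≫ P.restrict.map g) : f = g := by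
  refine ((Adjunction.ofIsRightAdjoint P.restrict).homEquiv M N).injective ?_
  exact (Adjunction.homEquiv_unit _ _ _ _).trans
    (h.trans (Adjunction.homEquiv_unit _ _ _ _).symm)

/-- The map `freeHom` factors through the unit. Conversely the unit sends x to P(x) applied to the
image a of the generator. -/
lemma Mor.unit_free_eq_iff {n k : ℕ} (x y : (T'.free n).carrier k) :
    homApp (P.unit (T'.free n)) x = homApp (P.unit (T'.free n)) y ↔
      homApp (P.freeHom n) x = homApp (P.freeHom n) y := by
  constructor
  · intro h
    rw [← P.homApp_desc, h, P.homApp_desc]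
  · intro h
    let a : (P.extend.obj (T'.free n)).carrier n :=
      elt (M := P.reflect (T'.free n)) (P.unit (T'.free n))
    have e (x : (T'.free n).carrier k) : homApp (P.unit (T'.free n)) x =
        Model.app (P.extend.obj (T'.free n)) (P.map (m := n) (n := k) x) a :=
      homApp_free (P.unit (T'.free n)) x
    rw [e, e]
    exact congrArg (fun s => Model.app (P.extend.obj (T'.free n)) s a) h

/-- The generator a of the extended free model goes to the identity of X^n in T(n). If η(x) = t(a),
then applying this map gives P(x) = t. -/
lemma Mor.full_of_surjective
    (h : ∀ n k : ℕ, Function.Surjective (homApp (P.unit (T'.free n)) (n := k))) : P.Full := by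
  intro n k t
  let E := P.extend.obj (T'.free n)
  let a : E.carrier n := elt (M := P.reflect (T'.free n)) (P.unit (T'.free n))
  obtain ⟨x, hx⟩ := h n k (Model.app E t a)
  refine ⟨x, ?_⟩
  have e := P.homApp_desc (P.freeHom n) x
  rw [hx] at e
  refine e.symm.trans ((homApp_app (M := E) (N := T.free n) (P.desc (P.freeHom n)) t a).trans ?_)
  have e1 : homApp (M := E) (N := T.free n) (P.desc (P.freeHom n)) a = 𝟙 (T.pow n) :=
    (P.homApp_desc (P.freeHom n) (show (T'.free n).carrier n from 𝟙 (T'.pow n))).trans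
      (P.functor.map_id (T'.pow n))
  rw [e1]
  exact Category.id_comp t

lemma Mor.extend_map_eq_iff {M N : T'.Model} (f g : M ⟶ N) :
    P.extend.map f = P.extend.map g ↔ f ≫ P.unit N = g ≫ P.unit N := by
  have e (f : M ⟶ N) : P.unit M ≫ P.restrict.map (P.extend.map f) = f ≫ P.unit N :=
    (Adjunction.ofIsRightAdjoint P.restrict).unit_naturality f
  constructor
  · intro h
    rw [← e, ← e, h]
  · intro h
    refine P.extend_hom_ext ?_
    rw [e, e, h]

lemma Mor.extend_map_free_eq_iff {n k : ℕ} (f g : T'.free n ⟶ T'.free k) :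
    P.extend.map f = P.extend.map g ↔ P.map (homOfFree f) = P.map (homOfFree g) := by
  rw [P.extend_map_eq_iff]
  refine Iff.trans ?_ (P.unit_free_eq_iff (elt f) (elt g))
  rw [← elt_comp, ← elt_comp]
  exact ⟨fun h => congrArg elt h, fun h => by rw [← point_elt (f ≫ _), h, point_elt]⟩

/-- Homomorphisms of free models are precompositions with morphisms of T', and both equalities
assumed in ♢ become equalities after P. -/
lemma Mor.diamond_iff : P.Diamond ↔ ∀ p : T'.pow 3 ⟶ T'.pow 1, T'.IsMaltsevOp p →
    ∀ (n k : ℕ) (u v : T'.pow k ⟶ T'.pow n), P.map u = P.map v →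
      ∀ x y : T'.pow n ⟶ T'.pow 1, P.map x = P.map y →
        triHom p (u ≫ x) (v ≫ x) (v ≫ y) = u ≫ y := by
  have e (p : T'.pow 3 ⟶ T'.pow 1) {k : ℕ} (a b c : T'.pow k ⟶ T'.pow 1) :
      triHom p a b c = (T'.free k).operation p ![a, b, c] := tri_one (M := T'.free k) a b c
  constructor
  · intro h p hp n k u v huv x y hxy
    have h1 := h p hp n k (freeMap u) (freeMap v)
      ((P.extend_map_free_eq_iff _ _).2 (by rw [homOfFree_freeMap, homOfFree_freeMap, huv])) x y
      ((P.unit_free_eq_iff (n := n) (k := 1) x y).2 hxy)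
    have h2 (t : T'.pow k ⟶ T'.pow n) (x : T'.pow n ⟶ T'.pow 1) :
        mapCarrier (freeMap t) x = t ≫ x := rfl
    rw [h2, h2, h2, h2] at h1
    exact (e p _ _ _).trans h1
  · intro h p hp n k f g hfg x y hxy
    have h1 := h p hp n k (homOfFree f) (homOfFree g) ((P.extend_map_free_eq_iff f g).1 hfg) x y
      ((P.unit_free_eq_iff (n := n) (k := 1) x y).1 hxy)
    rw [e] at h1
    have h2 := mapCarrier_free f
    have h3 := mapCarrier_free g
    exact (congrArg ((T'.free k).operation p) (by rw [h2 x, h3 x, h3 y])).trans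
      (h1.trans (h2 y).symm)

end Unit

namespace Model

variable {T : AlgTheory.{u}} (M : T.Model)

lemma exists_common {n : ℕ} (k : Fin n → ℕ) (c : ∀ i, M.carrier (k i)) :
    ∃ (j : ℕ) (e : M.carrier j) (π : ∀ i, T.pow j ⟶ T.pow (k i)), ∀ i, M.app (π i) e = c i := by
  obtain ⟨e, he, -⟩ := existsUnique_of_coords ((T.isModel_iff _).1 M.2) k c
  exact ⟨_, e, T.sumProj k, he⟩

lemma exists_common₂ {k l : ℕ} (c : M.carrier k) (d : M.carrier l) :
    ∃ (j : ℕ) (e : M.carrier j) (π : T.pow j ⟶ T.pow k) (ρ : T.pow j ⟶ T.pow l),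
      M.app π e = c ∧ M.app ρ e = d := by
  refine ⟨k + l, M.tuple (Fin.append (fun i => M.app (T.proj i) c) fun i => M.app (T.proj i) d),
    T.str (Fin.castAdd l), T.str (Fin.natAdd k), ?_, ?_⟩
  · rw [app_str_tuple]
    simp only [Fin.append_left, tuple_app_proj]
  · rw [app_str_tuple]
    simp only [Fin.append_right, tuple_app_proj]

end Model

/-! ### The kernel of the unit for full P, and reduction of affineness to free models -/

section Kernel

variable {T' T : AlgTheory.{u}} (P : Mor T' T) (M : T'.Model)

/-- Two elements are related if they are values at the same arguments of operations which become
equal in `T`. -/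
def Mor.Rel {n : ℕ} (x y : M.carrier n) : Prop :=
  ∃ (k : ℕ) (c : M.carrier k) (s s' : T'.pow k ⟶ T'.pow n), P.map s = P.map s' ∧
    M.app s c = x ∧ M.app s' c = y

variable {P M}

lemma Mor.Rel.symm {n : ℕ} {x y : M.carrier n} (h : P.Rel M x y) : P.Rel M y x := by
  obtain ⟨k, c, s, s', h, hx, hy⟩ := h
  exact ⟨k, c, s', s, h.symm, hy, hx⟩

lemma Mor.Rel.refl {n : ℕ} (x : M.carrier n) : P.Rel M x x :=
  ⟨n, x, 𝟙 _, 𝟙 _, rfl, M.app_id x, M.app_id x⟩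

lemma Mor.Rel.app {m n : ℕ} (t : T'.pow m ⟶ T'.pow n) {x y : M.carrier m} (h : P.Rel M x y) :
    P.Rel M (M.app t x) (M.app t y) := by
  obtain ⟨k, c, s, s', h, hx, hy⟩ := h
  exact ⟨k, c, s ≫ t, s' ≫ t, by rw [P.map_comp, h, P.map_comp], by rw [app_comp, hx],
    by rw [app_comp, hy]⟩

lemma Mor.Rel.app_of_eq {m n : ℕ} {t t' : T'.pow m ⟶ T'.pow n} (h : P.map t = P.map t')
    (x : M.carrier m) : P.Rel M (M.app t x) (M.app t' x) := ⟨m, x, t, t', h, rfl, rfl⟩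

lemma Mor.Rel.exists_common {n : ℕ} {x y z w : M.carrier n} (h : P.Rel M x y)
    (h' : P.Rel M z w) : ∃ (j : ℕ) (e : M.carrier j) (r r' s s' : T'.pow j ⟶ T'.pow n),
      P.map r = P.map r' ∧ P.map s = P.map s' ∧ M.app r e = x ∧ M.app r' e = y ∧
        M.app s e = z ∧ M.app s' e = w := by
  obtain ⟨k, c, s, s', h, rfl, rfl⟩ := h
  obtain ⟨l, d, t, t', h', rfl, rfl⟩ := h'
  obtain ⟨j, e, π, ρ, rfl, rfl⟩ := M.exists_common₂ c d
  exact ⟨j, e, π ≫ s, π ≫ s', ρ ≫ t, ρ ≫ t', by rw [P.map_comp, h, P.map_comp],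
    by rw [P.map_comp, h', P.map_comp], M.app_comp _ _ _, M.app_comp _ _ _, M.app_comp _ _ _,
    M.app_comp _ _ _⟩

lemma Mor.Rel.trans (hT' : T'.IsMaltsev) {n : ℕ} {x y z : M.carrier n} (h : P.Rel M x y)
    (h' : P.Rel M y z) : P.Rel M x z := by
  obtain ⟨p, hp⟩ := hT'
  obtain ⟨j, e, r, r', s, s', hr, hs, hx, hy, hy', hz⟩ := h.exists_common h'
  -- The usual Maltsev argument: at e these take the values p(x, y, y) = x and p(y, y, z) = z.
  refine ⟨j, e, triHom p r r' s, triHom p r' r' s',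
    P.map_triHom p hr rfl hs, ?_, ?_⟩
  · rw [app_triHom, hx, hy, hy', tri_right hp]
  · rw [app_triHom, hy, hz, tri_left hp]

/-- The arguments witnessing the n coordinate relations are bundled into one element e, and the
operations are tupled. -/
lemma Mor.Rel.of_proj {n : ℕ} {x y : M.carrier n}
    (h : ∀ i : Fin n, P.Rel M (M.app (T'.proj i) x) (M.app (T'.proj i) y)) : P.Rel M x y := by
  choose k c s s' hs hx hy using h
  obtain ⟨j, e, π, hπ⟩ := M.exists_common k c
  obtain ⟨S, hS, -⟩ := T'.existsUnique_proj fun i => π i ≫ s i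
  obtain ⟨S', hS', -⟩ := T'.existsUnique_proj fun i => π i ≫ s' i
  refine ⟨j, e, S, S', T.hom_ext fun i => ?_, elt_ext fun i => ?_, elt_ext fun i => ?_⟩
  · have e : P.map (T'.proj i) = T.proj i := P.map_str _
    rw [← e, ← P.map_comp, ← P.map_comp, hS, hS', P.map_comp, hs, P.map_comp]
  · rw [← app_comp, hS, app_comp, hπ, hx]
  · rw [← app_comp, hS', app_comp, hπ, hy]

variable (P M) in
/-- The relation `Rel` as a setoid. -/
def Mor.relSetoid (hT' : T'.IsMaltsev) (n : ℕ) : Setoid (M.carrier n) where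
  r := P.Rel M
  iseqv := ⟨Mor.Rel.refl, Mor.Rel.symm, Mor.Rel.trans hT'⟩

/-- The quotient of `M` by `Rel`, as a model of `T`. -/
noncomputable def Mor.quotModel (hP : P.Full) (hT' : T'.IsMaltsev) (M : T'.Model) : T.Model :=
  -- Any two lifts of t give related values, so the chosen lift may be replaced by a convenient one.
  have key {m n : ℕ} (t : T.pow m ⟶ T.pow n) (s : T'.pow m ⟶ T'.pow n) (h : P.map s = t)
      (x : M.carrier m) : P.Rel M (M.app (hP m n t).choose x) (M.app s x) :=
    .app_of_eq ((hP m n t).choose_spec.trans h.symm) x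
  ofApp (fun n => Quotient (P.relSetoid M hT' n))
    (fun {m n} t => Quotient.map (M.app (hP m n t).choose) fun _ _ h => h.app _)
    (fun {n} x => by
      induction x using Quotient.inductionOn with | h x => ?_
      refine Quotient.sound ?_
      have := key (𝟙 (T.pow n)) (𝟙 (T'.pow n)) (P.functor.map_id (T'.pow n)) x
      rwa [app_id] at this)
    (fun {l m n} s t x => by
      induction x using Quotient.inductionOn with | h x => ?_
      refine Quotient.sound ?_
      have := key (s ≫ t) ((hP l m s).choose ≫ (hP m n t).choose)
        (by rw [P.map_comp, (hP l m s).choose_spec, (hP m n t).choose_spec]) x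
      rwa [app_comp] at this)
    fun n => by
      constructor
      · intro x y h
        induction x using Quotient.inductionOn with | h x => ?_
        induction y using Quotient.inductionOn with | h y => ?_
        refine Quotient.sound (Mor.Rel.of_proj fun i => ?_)
        have h1 := Quotient.exact (congrFun h i)
        have h2 := key (T.proj i) (T'.proj i) (P.map_str _)
        exact ((h2 x).symm.trans hT' h1).trans hT' (h2 y)
      · intro x
        choose y hy using fun i => Quotient.exists_rep (x i)
        refine ⟨Quotient.mk _ (M.tuple y), funext fun i => ?_⟩
        rw [← hy i]
        refine Quotient.sound ?_
        have := key (T.proj i) (T'.proj i) (P.map_str _) (M.tuple y)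
        rwa [app_proj_tuple] at this

variable (hP : P.Full) (hT' : T'.IsMaltsev)

/-- The class of an element. -/
def Mor.toQuot {n : ℕ} (x : M.carrier n) : (Mor.quotModel hP hT' M).carrier n :=
  Quotient.mk (P.relSetoid M hT' n) x

lemma Mor.app_toQuot {m n : ℕ} (t : T'.pow m ⟶ T'.pow n) (x : M.carrier m) :
    Model.app (Mor.quotModel hP hT' M) (P.map t) (Mor.toQuot hP hT' x) =
      Mor.toQuot hP hT' (M.app t x) :=
  Quotient.sound (.app_of_eq (hP m n (P.map t)).choose_spec x)

/-- The projection to the quotient. -/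
noncomputable def Mor.quotHom (M : T'.Model) : M ⟶ P.restrict.obj (Mor.quotModel hP hT' M) :=
  mkHom (N := P.restrict.obj (Mor.quotModel hP hT' M)) (fun _ x => Mor.toQuot hP hT' x)
    fun t x => (Mor.app_toQuot hP hT' t x).symm

lemma Mor.unit_eq_of_rel {n : ℕ} {x y : M.carrier n} (h : P.Rel M x y) :
    homApp (P.unit M) x = homApp (P.unit M) y := by
  obtain ⟨k, c, s, s', h, rfl, rfl⟩ := h
  rw [homApp_app, homApp_app]
  exact congrArg (fun t => Model.app (P.extend.obj M) t (homApp (P.unit M) c)) h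

-- The quotient by `Rel` is a T-model, so M → M/`Rel` factors through the unit, which therefore
-- identifies nothing more.
include hP hT' in
lemma Mor.unit_eq_iff {n : ℕ} {x y : M.carrier n} :
    homApp (P.unit M) x = homApp (P.unit M) y ↔ P.Rel M x y := by
  refine ⟨fun h => ?_, Mor.unit_eq_of_rel⟩
  have e := P.homApp_desc (Mor.quotHom hP hT' M) (n := n)
  exact Quotient.exact ((e x).symm.trans ((congrArg _ h).trans (e y)))

include hP hT' in
lemma Mor.unit_surjective (M : T'.Model) (n : ℕ) :
    Function.Surjective (homApp (P.unit M) (n := n)) := by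
  let N := Mor.quotModel hP hT' M
  let E := P.extend.obj M
  let j : N ⟶ E := mkHom (M := N) (N := E)
    (fun n x => Quotient.lift (s := P.relSetoid M hT' n) (homApp (P.unit M) (n := n))
      (fun _ _ h => Mor.unit_eq_of_rel h) x) fun {m n} t x => by
        obtain ⟨s, rfl⟩ := hP m n t
        induction x using Quotient.inductionOn with | h x => ?_
        refine (congrArg _ (Mor.app_toQuot hP hT' s x)).trans ?_
        exact homApp_app (P.unit M) s x
  -- By the universal property of the unit the extension is a retract of M/`Rel`, so all its
  -- elements come from M.
  have h : P.desc (Mor.quotHom hP hT' M) ≫ j = 𝟙 E := by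
    refine P.extend_hom_ext (Model.hom_ext fun n x => ?_)
    exact congrArg (homApp j) (P.homApp_desc (Mor.quotHom hP hT' M) x)
  intro y
  obtain ⟨x, hx⟩ := Quotient.exists_rep (homApp (N := N) (n := n) (P.desc (Mor.quotHom hP hT' M)) y)
  refine ⟨x, ?_⟩
  have e := congrArg (fun k : E ⟶ E => homApp k y) h
  refine Eq.trans ?_ e
  exact congrArg (homApp (n := n) j) hx

-- The triple x, y, z is lifted to morphisms r, r', r'' evaluated at one element e, with the
-- corresponding equalities after P. The identity then holds in a free model and is evaluated at e.
include hP hT' in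
lemma Mor.affine_unit {p : T'.pow 3 ⟶ T'.pow 1} (hp : T'.IsMaltsevOp p) {c : Prop}
    (h : ∀ k, Affine p (P.freeHom k) c) (M : T'.Model) : Affine p (P.unit M) c := by
  intro m n t x y z hxy hyz
  have key : ∃ (j : ℕ) (e : M.carrier j) (r r' r'' : T'.pow j ⟶ T'.pow m), P.map r = P.map r' ∧
      (c → P.map r' = P.map r'') ∧ M.app r e = x ∧ M.app r' e = y ∧ M.app r'' e = z := by
    rw [Mor.unit_eq_iff hP hT'] at hxy
    by_cases hc : c
    · have hyz := (Mor.unit_eq_iff hP hT').1 (hyz hc)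
      obtain ⟨j, e, r, r', s, s', hr, hs, hx, hy, hy', hz⟩ := hxy.exists_common hyz
      -- The two relations lift y differently, to r' and s. The morphism r' − s + s' still takes the
      -- value z at e and has the same image as r' under P.
      refine ⟨j, e, r, r', triHom p r' s s', hr, fun _ => ?_, hx, hy, ?_⟩
      · refine Eq.trans ?_ (P.map_triHom p rfl rfl hs)
        rw [triHom_right hp]
      · rw [app_triHom, hy, hy', hz, tri_left hp]
    · obtain ⟨k, d, s, s', hs, rfl, rfl⟩ := hxy
      obtain ⟨j, e, π, ρ, rfl, rfl⟩ := M.exists_common₂ d z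
      exact ⟨j, e, π ≫ s, π ≫ s', ρ, by rw [P.map_comp, hs, P.map_comp], fun h => (hc h).elim,
        M.app_comp _ _ _, M.app_comp _ _ _, rfl⟩
  obtain ⟨j, e, r, r', r'', hr, hr', rfl, rfl, rfl⟩ := key
  have h1 : triHom p r r' r'' ≫ t = triHom p (r ≫ t) (r' ≫ t) (r'' ≫ t) :=
    h j (m := m) (n := n) t r r' r'' hr hr'
  rw [← app_triHom, ← app_comp, h1, app_triHom, app_comp, app_comp, app_comp]

end Kernel

open Model

/-! ### From linear extensions to affineness and ♢ -/

section Parallel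

variable {T' T : AlgTheory.{u}} {P : Mor T' T}

/-- A relation `u - w = u' - w'` between quadruples of morphisms of `T'` -/
structure Mor.Parallelism (P : Mor T' T) (c : Prop) where
  /-- the relation -/
  rel {k n : ℕ} (u w u' w' : T'.pow k ⟶ T'.pow n) : Prop
  refl {k n : ℕ} {u w : T'.pow k ⟶ T'.pow n} : P.map u = P.map w → rel u w u w
  diag {k n : ℕ} {u w : T'.pow k ⟶ T'.pow n} : (c → P.map u = P.map w) → rel u u w w
  post {k n m : ℕ} {u w u' w' : T'.pow k ⟶ T'.pow n} (t : T'.pow n ⟶ T'.pow m) :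
    rel u w u' w' → rel (u ≫ t) (w ≫ t) (u' ≫ t) (w' ≫ t)
  prod {k n : ℕ} {u w u' w' : T'.pow k ⟶ T'.pow n} :
    (∀ i, rel (u ≫ T'.proj i) (w ≫ T'.proj i) (u' ≫ T'.proj i) (w' ≫ T'.proj i)) → rel u w u' w'
  uniq {k n : ℕ} {u v w u' w' : T'.pow k ⟶ T'.pow n} : rel u w u' w' → rel v w u' w' → u = v
  -- The difference of s ≫ t and s' ≫ t depends on t only through P(t); this is the source of ♢.
  comp {k n m : ℕ} {s s' : T'.pow k ⟶ T'.pow n} {t t' : T'.pow n ⟶ T'.pow m} :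
    P.map s = P.map s' → P.map t = P.map t' → rel (s ≫ t) (s' ≫ t) (s ≫ t') (s' ≫ t')

namespace Mor.Parallelism

variable {c : Prop} (Q : P.Parallelism c) {p : T'.pow 3 ⟶ T'.pow 1}

/-- That is, p(x, y, z) − z = x − y: with `uniq`, this determines p(x, y, z) by parallelism alone.
-/
lemma rel_triHom (hp : T'.IsMaltsevOp p) {k n : ℕ} {x y z : T'.pow k ⟶ T'.pow n}
    (h : P.map x = P.map y) (h' : c → P.map y = P.map z) : Q.rel (triHom p x y z) z x y := by
  refine Q.prod fun i => ?_
  have e : triHom p x y z ≫ T'.proj i =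
      triHom p (x ≫ T'.proj i) (y ≫ T'.proj i) (z ≫ T'.proj i) :=
    app_proj_tri' (M := T'.free k) (n := n) x y z i
  have h1 : P.map (x ≫ T'.proj i) = P.map (y ≫ T'.proj i) := by rw [P.map_comp, h, P.map_comp]
  have h2 : c → P.map (y ≫ T'.proj i) = P.map (z ≫ T'.proj i) := fun hc => by
    rw [P.map_comp, h' hc, P.map_comp]
  rw [e]
  generalize x ≫ T'.proj i = x at h1 ⊢
  generalize y ≫ T'.proj i = y at h1 h2 ⊢
  generalize z ≫ T'.proj i = z at h2 ⊢
  obtain ⟨F, hF, hF'⟩ : ∃ F : (Fin 3 → (T'.pow k ⟶ T'.pow 1)) → (T'.pow k ⟶ T'.pow 3),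
      (∀ a i, F a ≫ T'.proj i = a i) ∧ ∀ a b c, F ![a, b, c] ≫ p = triHom p a b c :=
    ⟨(T'.free k).tuple, (T'.free k).app_proj_tuple, fun a b c =>
      (tri_one (M := T'.free k) a b c).symm⟩
  -- Coordinatewise the differences are x − y, 0, 0 on both sides. Composing with p gives p(x, y, z)
  -- − z = x − y.
  have key : Q.rel (F ![x, y, z]) (F ![y, y, z]) (F ![x, y, y]) (F ![y, y, y]) := by
    refine Q.prod fun i => ?_
    rw [hF, hF, hF, hF]
    fin_cases i
    · exact Q.refl h1
    · exact Q.refl rfl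
    · exact Q.diag fun hc => (h2 hc).symm
  have := Q.post p key
  rwa [hF', hF', hF', hF', triHom_left hp, triHom_right hp, triHom_right hp] at this

lemma affine (Q : P.Parallelism c) (hp : T'.IsMaltsevOp p) (k : ℕ) : Affine p (P.freeHom k) c := by
  intro m n t x y z h h'
  have h1 := Q.post t (Q.rel_triHom hp (n := m) h h')
  have h2 := Q.rel_triHom hp (homApp_app_congr (f := P.freeHom k) h t)
    fun hc => homApp_app_congr (f := P.freeHom k) (h' hc) t
  exact Q.uniq h1 h2

lemma diamond (Q : P.Parallelism c) : P.Diamond := by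
  rw [Mor.diamond_iff]
  intro p hp n k u v h x y h'
  refine Q.uniq (Q.rel_triHom hp ?_ fun _ => ?_) (Q.comp h h'.symm)
  · rw [P.map_comp, h, P.map_comp]
  · rw [P.map_comp, h', P.map_comp]

end Mor.Parallelism

namespace LinearExtension

variable {D : TwistedArrow T.Obj ⥤ AddCommGrpCat.{u}} (L : LinearExtension P D)

lemma full (L : LinearExtension P D) : P.Full := by
  intro m n b
  obtain ⟨e, he⟩ := (L.torsor b).nonempty
  exact ⟨e, he⟩

/-- The element `e - e'` of `D_b`. -/
def diff {m n : ℕ} (b : T.pow m ⟶ T.pow n) (e e' : P.Fiber b) :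
    D.obj ⟨T.pow m, T.pow n, b⟩ := (L.torsor b).vsub e e'

lemma diff_self {m n : ℕ} (b : T.pow m ⟶ T.pow n) (e : P.Fiber b) : L.diff b e e = 0 :=
  letI := L.torsor b
  vsub_self e

lemma diff_left_injective {m n : ℕ} {b : T.pow m ⟶ T.pow n} {e e' d : P.Fiber b}
    (h : L.diff b e d = L.diff b e' d) : e = e' :=
  letI := L.torsor b
  vsub_left_cancel h

lemma exists_diff_eq {m n : ℕ} {b : T.pow m ⟶ T.pow n} (x : D.obj ⟨T.pow m, T.pow n, b⟩)
    (d : P.Fiber b) : ∃ e, L.diff b e d = x :=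
  letI := L.torsor b
  ⟨x +ᵥ d, vadd_vsub x d⟩

/-- The distributive law with zero on the second factor; the right-hand side involves b but not the
lift e. -/
lemma diff_comp {l m n : ℕ} {a : T.pow l ⟶ T.pow m} {b : T.pow m ⟶ T.pow n}
    (d d' : P.Fiber a) (e : P.Fiber b) : L.diff (a ≫ b) (d.comp e) (d'.comp e) =
      D.map (TwistedArrow.post a b) (L.diff a d d') := by
  let := L.torsor a
  let := L.torsor b
  let := L.torsor (a ≫ b)
  have h := L.vadd_comp_vadd d' e (d -ᵥ d') 0
  rw [vsub_vadd, zero_vadd, map_zero, zero_add] at h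
  change (d.comp e) -ᵥ (d'.comp e) = D.map (TwistedArrow.post a b) (d -ᵥ d')
  rw [h, vadd_vsub]

/-- Equality of differences in a linear extension. -/
def parallelism : P.Parallelism True where
  rel {k n} u w u' w' := ∃ (b : T.pow k ⟶ T.pow n) (hu : P.map u = b) (hw : P.map w = b)
    (hu' : P.map u' = b) (hw' : P.map w' = b),
    L.diff b ⟨u, hu⟩ ⟨w, hw⟩ = L.diff b ⟨u', hu'⟩ ⟨w', hw'⟩
  refl {k n u w} h := ⟨_, h, rfl, h, rfl, rfl⟩
  diag {k n u w} h := ⟨_, h trivial, h trivial, rfl, rfl,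
    (L.diff_self _ _).trans (L.diff_self _ _).symm⟩
  post {k n m u w u' w'} t := by
    rintro ⟨b, hu, hw, hu', hw', h⟩
    have e {v : T'.pow k ⟶ T'.pow n} (hv : P.map v = b) : P.map (v ≫ t) = b ≫ P.map t := by
      rw [P.map_comp, hv]
    refine ⟨b ≫ P.map t, e hu, e hw, e hu', e hw', ?_⟩
    have h1 := L.diff_comp ⟨u, hu⟩ ⟨w, hw⟩ (⟨t, rfl⟩ : P.Fiber (P.map t))
    have h2 := L.diff_comp ⟨u', hu'⟩ ⟨w', hw'⟩ (⟨t, rfl⟩ : P.Fiber (P.map t))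
    rw [h] at h1
    exact h1.trans h2.symm
  prod {k n u w u' w'} h := by
    have hpr (i : Fin n) : P.map (T'.proj i) = T.proj i := P.map_str _
    have e {v v' : T'.pow k ⟶ T'.pow n}
        (h : ∀ i, P.map (v ≫ T'.proj i) = P.map (v' ≫ T'.proj i)) : P.map v = P.map v' :=
      T.hom_ext fun i => by rw [← hpr, ← P.map_comp, h, P.map_comp]
    have hw : P.map w = P.map u := e fun i => by
      obtain ⟨b, hu, hw, hu', hw', -⟩ := h i
      rw [hu, hw]
    have hu' : P.map u' = P.map u := e fun i => by
      obtain ⟨b, hu, hw, hu', hw', -⟩ := h i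
      rw [hu, hu']
    have hw' : P.map w' = P.map u := e fun i => by
      obtain ⟨b, hu, hw, hu', hw', -⟩ := h i
      rw [hu, hw']
    refine ⟨P.map u, rfl, hw, hu', hw', ?_⟩
    -- No compatibility of D with products is needed: transitivity gives v with v − w = u' − w', and
    -- v has the same coordinates as u because the actions are free.
    obtain ⟨⟨v, hv⟩, hvd⟩ := L.exists_diff_eq (L.diff (P.map u) ⟨u', hu'⟩ ⟨w', hw'⟩) ⟨w, hw⟩
    have hvu : v = u := T'.hom_ext fun i => by
      obtain ⟨b, hub, hwb, hub', hwb', hb⟩ := h i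
      obtain rfl : P.map u ≫ P.map (T'.proj i) = b := by rw [← P.map_comp, hub]
      have h1 := L.diff_comp ⟨v, hv⟩ ⟨w, hw⟩ (⟨T'.proj i, rfl⟩ : P.Fiber (P.map (T'.proj i)))
      have h2 := L.diff_comp ⟨u', hu'⟩ ⟨w', hw'⟩ (⟨T'.proj i, rfl⟩ : P.Fiber (P.map (T'.proj i)))
      rw [hvd] at h1
      exact congrArg Subtype.val (L.diff_left_injective (h1.trans (h2.symm.trans hb.symm)))
    subst hvu
    exact hvd
  uniq {k n u v w u' w'} := by
    rintro ⟨b, hu, hw, hu', hw', h⟩ ⟨b', hv, rfl, hu'', hw'', h'⟩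
    obtain rfl := hw
    exact congrArg Subtype.val (L.diff_left_injective (h.trans h'.symm))
  comp {k n m s s' t t'} hs ht := by
    have e {v : T'.pow k ⟶ T'.pow n} {r : T'.pow n ⟶ T'.pow m} (hv : P.map v = P.map s')
        (hr : P.map r = P.map t') : P.map (v ≫ r) = P.map s' ≫ P.map t' := by
      rw [P.map_comp, hv, hr]
    refine ⟨P.map s' ≫ P.map t', e hs ht, e rfl ht, e hs rfl, e rfl rfl, ?_⟩
    exact (L.diff_comp ⟨s, hs⟩ ⟨s', rfl⟩ (⟨t, ht⟩ : P.Fiber (P.map t'))).trans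
      (L.diff_comp ⟨s, hs⟩ ⟨s', rfl⟩ (⟨t', rfl⟩ : P.Fiber (P.map t'))).symm

end LinearExtension

namespace LinearExtension

variable {D : T.Objᵒᵖ × T.Obj ⥤ AddCommGrpCat.{u}}
  (L : LinearExtension P (TwistedArrow.toProd ⋙ D))

/-- The element `e - e'` of `D(X^m, X^n)`. -/
def bidiff {m n : ℕ} {b : T.pow m ⟶ T.pow n} (e e' : P.Fiber b) :
    D.obj (op (T.pow m), T.pow n) := L.diff b e e'

lemma bidiff_self {m n : ℕ} {b : T.pow m ⟶ T.pow n} (e : P.Fiber b) : L.bidiff e e = 0 :=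
  L.diff_self b e

lemma bidiff_comp {l m n : ℕ} {a : T.pow l ⟶ T.pow m} {b : T.pow m ⟶ T.pow n}
    (d d' : P.Fiber a) (e : P.Fiber b) : L.bidiff (d.comp e) (d'.comp e) =
      D.map (X := (op (T.pow l), T.pow m)) (Y := (op (T.pow l), T.pow n))
        ((𝟙 (T.pow l)).op, b) (L.bidiff d d') :=
  L.diff_comp d d' e

/-- Equality of differences in an untwisted linear extension. -/
def biparallelism : P.Parallelism False where
  rel {k n} u w u' w' := ∃ (b b' : T.pow k ⟶ T.pow n) (hu : P.map u = b) (hw : P.map w = b)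
    (hu' : P.map u' = b') (hw' : P.map w' = b'),
    L.bidiff (⟨u, hu⟩ : P.Fiber b) ⟨w, hw⟩ = L.bidiff (⟨u', hu'⟩ : P.Fiber b') ⟨w', hw'⟩
  refl {k n u w} h := ⟨_, _, h, rfl, h, rfl, rfl⟩
  diag {k n u w} h := ⟨_, _, rfl, rfl, rfl, rfl,
    (L.bidiff_self (b := P.map u) ⟨u, rfl⟩).trans (L.bidiff_self (b := P.map w) ⟨w, rfl⟩).symm⟩
  post {k n m u w u' w'} t := by
    rintro ⟨b, b', hu, hw, hu', hw', h⟩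
    have e {v : T'.pow k ⟶ T'.pow n} {b : T.pow k ⟶ T.pow n} (hv : P.map v = b) :
        P.map (v ≫ t) = b ≫ P.map t := by rw [P.map_comp, hv]
    refine ⟨b ≫ P.map t, b' ≫ P.map t, e hu, e hw, e hu', e hw', ?_⟩
    have h1 := L.bidiff_comp ⟨u, hu⟩ ⟨w, hw⟩ (⟨t, rfl⟩ : P.Fiber (P.map t))
    have h2 := L.bidiff_comp ⟨u', hu'⟩ ⟨w', hw'⟩ (⟨t, rfl⟩ : P.Fiber (P.map t))
    rw [h] at h1
    exact h1.trans h2.symm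
  prod {k n u w u' w'} h := by
    have hpr (i : Fin n) : P.map (T'.proj i) = T.proj i := P.map_str _
    have e {v v' : T'.pow k ⟶ T'.pow n}
        (h : ∀ i, P.map (v ≫ T'.proj i) = P.map (v' ≫ T'.proj i)) : P.map v = P.map v' :=
      T.hom_ext fun i => by rw [← hpr, ← P.map_comp, h, P.map_comp]
    have hw : P.map w = P.map u := e fun i => by
      obtain ⟨b, b', hu, hw, hu', hw', -⟩ := h i
      rw [hu, hw]
    have hw' : P.map w' = P.map u' := e fun i => by
      obtain ⟨b, b', hu, hw, hu', hw', -⟩ := h i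
      rw [hu', hw']
    refine ⟨P.map u, P.map u', rfl, hw, rfl, hw', ?_⟩
    obtain ⟨⟨v, hv⟩, hvd⟩ := L.exists_diff_eq (b := P.map u)
      (L.bidiff (⟨u', rfl⟩ : P.Fiber (P.map u')) ⟨w', hw'⟩) ⟨w, hw⟩
    have hvu : v = u := T'.hom_ext fun i => by
      obtain ⟨b, b', hub, hwb, hub', hwb', hb⟩ := h i
      obtain rfl : P.map u ≫ P.map (T'.proj i) = b := by rw [← P.map_comp, hub]
      obtain rfl : P.map u' ≫ P.map (T'.proj i) = b' := by rw [← P.map_comp, hub']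
      have h1 := L.bidiff_comp ⟨v, hv⟩ ⟨w, hw⟩ (⟨T'.proj i, rfl⟩ : P.Fiber (P.map (T'.proj i)))
      have h2 := L.bidiff_comp ⟨u', rfl⟩ ⟨w', hw'⟩ (⟨T'.proj i, rfl⟩ : P.Fiber (P.map (T'.proj i)))
      have hvd' : L.bidiff (⟨v, hv⟩ : P.Fiber (P.map u)) ⟨w, hw⟩ =
        L.bidiff (⟨u', rfl⟩ : P.Fiber (P.map u')) ⟨w', hw'⟩ := hvd
      rw [hvd'] at h1
      exact congrArg Subtype.val (L.diff_left_injective (h1.trans (h2.symm.trans hb.symm)))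
    subst hvu
    exact hvd
  uniq {k n u v w u' w'} := by
    rintro ⟨b, d, hu, rfl, rfl, hw', h⟩ ⟨b', d', hv, rfl, rfl, hw'', h'⟩
    exact congrArg Subtype.val (L.diff_left_injective (h.trans h'.symm))
  comp {k n m s s' t t'} hs ht := by
    have e {v : T'.pow k ⟶ T'.pow n} {r : T'.pow n ⟶ T'.pow m} (hv : P.map v = P.map s')
        (hr : P.map r = P.map t') : P.map (v ≫ r) = P.map s' ≫ P.map t' := by
      rw [P.map_comp, hv, hr]
    refine ⟨_, _, e hs ht, e rfl ht, e hs rfl, e rfl rfl, ?_⟩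
    exact (L.bidiff_comp ⟨s, hs⟩ ⟨s', rfl⟩ (⟨t, ht⟩ : P.Fiber (P.map t'))).trans
      (L.bidiff_comp ⟨s, hs⟩ ⟨s', rfl⟩ (⟨t', rfl⟩ : P.Fiber (P.map t'))).symm

end LinearExtension

end Parallel

end AlgTheory

/-! ### From affineness and ♢ to linear extensions -/

namespace Herd

variable {E : Type u} {H : Herd E}

lemma op_comm {x y z : E} (h : H.rel x y) (h' : H.rel z y) : H.op x y z = H.op z y x := by
  have e := H.comm y h h'
  rwa [H.op_right z y h', H.op_right x y h] at e

/-- The translation `map g d` equals g(d z) − g(z). By hypothesis it sends f(z) to f(d z), as `map f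
d` does. -/
lemma Diff.map_congr {E' : Type u} {H' : Herd E'} (f g : H.Hom H')
    (h : ∀ x y, H.rel x y → H'.op (g.toFun x) (g.toFun y) (f.toFun y) = f.toFun x) :
    map f = map g := by
  ext1 d
  refine map_eq f d _ (fun z => ?_) fun hE => by rw [eq_zero_of_isEmpty hE d, map_zero]
  rw [(map g d).val_eq_op (g.toFun z), map_val]
  exact h _ _ (d.rel_val z)

end Herd

namespace AlgTheory

open Model

section Converse

variable {T' T : AlgTheory.{u}} {P : Mor T' T} {p : T'.pow 3 ⟶ T'.pow 1} {c : Prop}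

/-- The condition `♢` for a given operation, in terms of composition of morphisms of theories. -/
def Mor.DiamondHom (P : Mor T' T) (p : T'.pow 3 ⟶ T'.pow 1) : Prop :=
  ∀ ⦃k n m : ℕ⦄ (u v : T'.pow k ⟶ T'.pow n) (x y : T'.pow n ⟶ T'.pow m), P.map u = P.map v →
    P.map x = P.map y → triHom p (u ≫ x) (v ≫ x) (v ≫ y) = u ≫ y

lemma Mor.Diamond.diamondHom (h : P.Diamond) (hp : T'.IsMaltsevOp p) : P.DiamondHom p := by
  intro k n m u v x y hu hx
  refine T'.hom_ext fun i => ?_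
  have e : triHom p (u ≫ x) (v ≫ x) (v ≫ y) ≫ T'.proj i =
      triHom p ((u ≫ x) ≫ T'.proj i) ((v ≫ x) ≫ T'.proj i) ((v ≫ y) ≫ T'.proj i) :=
    app_proj_tri' (M := T'.free k) (n := m) (u ≫ x) (v ≫ x) (v ≫ y) i
  rw [e]
  simp only [Category.assoc]
  exact P.diamond_iff.1 h p hp n k u v hu _ _ (by rw [P.map_comp, hx, P.map_comp])

lemma triHom_comp (ha : ∀ k, Affine p (P.freeHom k) c) {k n m : ℕ} {x y z : T'.pow k ⟶ T'.pow n}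
    (h : P.map x = P.map y) (h' : c → P.map y = P.map z) (t : T'.pow n ⟶ T'.pow m) :
    triHom p x y z ≫ t = triHom p (x ≫ t) (y ≫ t) (z ≫ t) :=
  ha k (m := n) (n := m) t x y z h h'

section Linear

variable (hp : T'.IsMaltsevOp p) (ha : ∀ k, Affine p (P.freeHom k) True)

/-- The fibre over a morphism, as a herd. -/
noncomputable def Mor.fiberHerd {k n : ℕ} (b : T.pow k ⟶ T.pow n) : Herd (P.Fiber b) :=
  (ha k).fiberHerd hp (n := n) b

/-- In difference form, l'xr' − l'yr' = lxr − lyr. First r' is exchanged for r, then l' for l, each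
by one use of ♢ (`h1`, `h2`); the intermediate base point is l'yr. -/
lemma Mor.triHom_conj (hp : T'.IsMaltsevOp p) (ha : ∀ k, Affine p (P.freeHom k) True)
    (hd : P.DiamondHom p) {k' k n n' : ℕ} {l l' : T'.pow k' ⟶ T'.pow k}
    {r r' : T'.pow n ⟶ T'.pow n'} {x y : T'.pow k ⟶ T'.pow n} (hl : P.map l = P.map l')
    (hr : P.map r = P.map r') (h : P.map x = P.map y) :
    triHom p (l' ≫ x ≫ r') (l' ≫ y ≫ r') (l ≫ y ≫ r) = l ≫ x ≫ r := by
  let H := Mor.fiberHerd hp ha (P.map (l' ≫ y ≫ r'))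
  have e {s : T'.pow k' ⟶ T'.pow k} {z : T'.pow k ⟶ T'.pow n} {t : T'.pow n ⟶ T'.pow n'}
      (hs : P.map s = P.map l') (hz : P.map z = P.map y) (ht : P.map t = P.map r') :
      P.map (s ≫ z ≫ t) = P.map (l' ≫ y ≫ r') := by
    rw [P.map_comp, P.map_comp, hs, hz, ht, ← P.map_comp, ← P.map_comp]
  let f (s : T'.pow k' ⟶ T'.pow k) (z : T'.pow k ⟶ T'.pow n) (t : T'.pow n ⟶ T'.pow n')
      (hs : P.map s = P.map l') (hz : P.map z = P.map y) (ht : P.map t = P.map r') :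
      P.Fiber (P.map (l' ≫ y ≫ r')) := ⟨s ≫ z ≫ t, e hs hz ht⟩
  have h1 : H.op (f l' x r' rfl h rfl) (f l' y r' rfl rfl rfl) (f l' y r rfl rfl hr) =
      f l' x r rfl h hr := by
    refine Subtype.ext ?_
    have := hd (l' ≫ x) (l' ≫ y) r' r (by rw [P.map_comp, h, P.map_comp]) hr.symm
    simp only [Category.assoc] at this
    exact this
  have h2 : H.op (f l y r hl rfl hr) (f l' y r rfl rfl hr) (f l' x r rfl h hr) =
      f l x r hl h hr :=
    Subtype.ext (hd l l' (y ≫ r) (x ≫ r) hl (by rw [P.map_comp, P.map_comp, h]))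
  have h3 : H.op (f l' x r' rfl h rfl) (f l' y r' rfl rfl rfl) (f l y r hl rfl hr) =
      f l x r hl h hr := by
    rw [← H.op_op (f l' y r rfl rfl hr) (f l y r hl rfl hr) trivial, h1,
      Herd.op_comm trivial trivial, h2]
  exact congrArg Subtype.val h3

/-- Composition on both sides, as a morphism of herds. -/
noncomputable def Mor.fiberConj {k' k n n' : ℕ} {b : T.pow k ⟶ T.pow n} {b' : T.pow k' ⟶ T.pow n'}
    (l : T'.pow k' ⟶ T'.pow k) (r : T'.pow n ⟶ T'.pow n') (h : P.map l ≫ b ≫ P.map r = b') :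
    (Mor.fiberHerd hp ha b).Hom (Mor.fiberHerd hp ha b') where
  toFun x := ⟨l ≫ x.1 ≫ r, by rw [P.map_comp, P.map_comp, x.2, h]⟩
  map_rel _ := trivial
  map_op {x y} z _ := Subtype.ext (by
    change l ≫ triHom p x.1 y.1 z.1 ≫ r = triHom p (l ≫ x.1 ≫ r) (l ≫ y.1 ≫ r) (l ≫ z.1 ≫ r)
    rw [triHom_comp ha (x.2.trans y.2.symm) fun _ => y.2.trans z.2.symm, comp_triHom])

lemma Mor.map_fiberConj (hd : P.DiamondHom p) {k' k n n' : ℕ} {b : T.pow k ⟶ T.pow n}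
    {b' : T.pow k' ⟶ T.pow n'} {l l' : T'.pow k' ⟶ T'.pow k} {r r' : T'.pow n ⟶ T'.pow n'}
    (hl : P.map l = P.map l') (hr : P.map r = P.map r') (h : P.map l ≫ b ≫ P.map r = b')
    (h' : P.map l' ≫ b ≫ P.map r' = b') :
    Herd.Diff.map (Mor.fiberConj hp ha l r h) = Herd.Diff.map (Mor.fiberConj hp ha l' r' h') :=
  Herd.Diff.map_congr _ _ fun x y _ =>
    Subtype.ext (Mor.triHom_conj hp ha hd hl hr (x.2.trans y.2.symm))

/-- The homomorphism of difference groups of fibres given by a factorization. -/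
noncomputable def Mor.fiberMap (hP : P.Full) {k' k n n' : ℕ} {b : T.pow k ⟶ T.pow n}
    {b' : T.pow k' ⟶ T.pow n'} (l : T.pow k' ⟶ T.pow k) (r : T.pow n ⟶ T.pow n')
    (h : l ≫ b ≫ r = b') :
    (Mor.fiberHerd hp ha b).Diff →+ (Mor.fiberHerd hp ha b').Diff :=
  Herd.Diff.map (Mor.fiberConj hp ha (hP _ _ l).choose (hP _ _ r).choose
    (by rw [(hP _ _ l).choose_spec, (hP _ _ r).choose_spec, h]))

lemma Mor.fiberMap_eq (hP : P.Full) (hd : P.DiamondHom p) {k' k n n' : ℕ} {b : T.pow k ⟶ T.pow n}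
    {b' : T.pow k' ⟶ T.pow n'} {l : T.pow k' ⟶ T.pow k} {r : T.pow n ⟶ T.pow n'}
    (h : l ≫ b ≫ r = b') {l' : T'.pow k' ⟶ T'.pow k} {r' : T'.pow n ⟶ T'.pow n'}
    (hl : P.map l' = l) (hr : P.map r' = r) :
    Mor.fiberMap hp ha hP l r h = Herd.Diff.map (Mor.fiberConj hp ha l' r' (by rw [hl, hr, h])) :=
  Mor.map_fiberConj hp ha hd ((hP _ _ l).choose_spec.trans hl.symm)
    ((hP _ _ r).choose_spec.trans hr.symm) _ _

lemma Mor.map_id (P : Mor T' T) (n : ℕ) : P.map (𝟙 (T'.pow n)) = 𝟙 (T.pow n) :=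
  P.functor.map_id (T'.pow n)

lemma Mor.fiberMap_id (hP : P.Full) (hd : P.DiamondHom p) {k n : ℕ} (b : T.pow k ⟶ T.pow n)
    (h : 𝟙 (T.pow k) ≫ b ≫ 𝟙 (T.pow n) = b) :
    Mor.fiberMap hp ha hP (𝟙 _) (𝟙 _) h = .id _ := by
  rw [Mor.fiberMap_eq hp ha hP hd _ (P.map_id _) (P.map_id _)]
  ext1 d
  exact Herd.Diff.map_id _ (fun x => Subtype.ext (by
    exact (Category.id_comp _).trans (Category.comp_id _))) d

lemma Mor.fiberMap_comp (hP : P.Full) (hd : P.DiamondHom p) {k k' k'' n n' n'' : ℕ}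
    {b : T.pow k ⟶ T.pow n} {b' : T.pow k' ⟶ T.pow n'} {b'' : T.pow k'' ⟶ T.pow n''}
    {l : T.pow k' ⟶ T.pow k} {r : T.pow n ⟶ T.pow n'} (h : l ≫ b ≫ r = b')
    {l' : T.pow k'' ⟶ T.pow k'} {r' : T.pow n' ⟶ T.pow n''} (h' : l' ≫ b' ≫ r' = b'')
    (h'' : (l' ≫ l) ≫ b ≫ (r ≫ r') = b'') :
    Mor.fiberMap hp ha hP (l' ≫ l) (r ≫ r') h'' =
      (Mor.fiberMap hp ha hP l' r' h').comp (Mor.fiberMap hp ha hP l r h) := by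
  obtain ⟨l, rfl⟩ := hP _ _ l
  obtain ⟨r, rfl⟩ := hP _ _ r
  obtain ⟨l', rfl⟩ := hP _ _ l'
  obtain ⟨r', rfl⟩ := hP _ _ r'
  rw [Mor.fiberMap_eq hp ha hP hd _ rfl rfl, Mor.fiberMap_eq hp ha hP hd _ rfl rfl,
    Mor.fiberMap_eq hp ha hP hd _ (P.map_comp _ _) (P.map_comp _ _)]
  ext1 d
  refine Herd.Diff.map_map _ _ _ (fun x => Subtype.ext ?_) d
  change (l' ≫ l) ≫ x.1 ≫ r ≫ r' = l' ≫ (l ≫ x.1 ≫ r) ≫ r'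
  simp only [Category.assoc]

/-- The natural system of difference groups of fibres. -/
noncomputable def Mor.fiberSystem (hP : P.Full) (hd : P.DiamondHom p) :
    TwistedArrow T.Obj ⥤ AddCommGrpCat.{u} where
  obj b := .of (Mor.fiberHerd hp ha (k := b.src) (n := b.tgt) b.hom).Diff
  map {b b'} f := AddCommGrpCat.ofHom (Mor.fiberMap hp ha hP (k' := b'.src) (k := b.src)
    (n := b.tgt) (n' := b'.tgt) f.l f.r f.fac)
  map_id b := AddCommGrpCat.hom_ext (Mor.fiberMap_id hp ha hP hd (k := b.src) (n := b.tgt) b.hom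
    (TwistedArrow.Hom.fac (𝟙 b)))
  map_comp {b b' b''} f g := AddCommGrpCat.hom_ext
    (Mor.fiberMap_comp hp ha hP hd (k := b.src) (k' := b'.src) (k'' := b''.src) (n := b.tgt)
      (n' := b'.tgt) (n'' := b''.tgt) f.fac g.fac
      (TwistedArrow.Hom.fac (f ≫ g)))

/-- The action of the difference group on a fibre. -/
@[reducible]
noncomputable def Mor.fiberTorsor (hP : P.Full) {k n : ℕ} (b : T.pow k ⟶ T.pow n) :
    AddTorsor (Mor.fiberHerd hp ha b).Diff (P.Fiber b) where
  vadd d e := d.1 e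
  zero_vadd _ := rfl
  add_vadd _ _ _ := rfl
  vsub x y := .sub x y trivial
  nonempty := (hP k n b).elim fun e he => ⟨⟨e, he⟩⟩
  vsub_vadd' x y := Herd.Diff.sub_val (H := Mor.fiberHerd hp ha b) (x := x) (y := y) trivial
  vadd_vsub' _ x := Herd.Diff.ext_of_apply x
    (Herd.Diff.sub_val (H := Mor.fiberHerd hp ha b) trivial)

/-- The linear extension by the difference groups of fibres. -/
noncomputable def Mor.linearExtension (hP : P.Full) (hd : P.DiamondHom p) :
    LinearExtension P (Mor.fiberSystem hp ha hP hd) where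
  torsor b := Mor.fiberTorsor hp ha hP b
  vadd_comp_vadd {l m n a b} d e (x : (Mor.fiberHerd hp ha a).Diff)
      (y : (Mor.fiberHerd hp ha b).Diff) := by
    -- The factors are translated one at a time. Since lifts may be chosen freely, b is lifted to e
    -- here, and in `h2` a is lifted to the already translated x + d.
    have h1 : (Mor.fiberMap hp ha hP (𝟙 _) b (Category.id_comp _) x).1 (d.comp e) =
        Mor.Fiber.comp (x.1 d) e := by
      rw [Mor.fiberMap_eq hp ha hP hd _ (P.map_id _) e.2]
      have e1 (d' : P.Fiber a) : d'.comp e = (Mor.fiberConj hp ha (b' := a ≫ b) (𝟙 _) e.1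
        (by rw [P.map_id, e.2, Category.id_comp])).toFun d' :=
          Subtype.ext (Category.id_comp _).symm
      rw [e1, e1, Herd.Diff.map_val]
    have h2 : (Mor.fiberMap hp ha hP a (𝟙 _) (by rw [Category.comp_id]) y).1
        (Mor.Fiber.comp (x.1 d) e) = Mor.Fiber.comp (x.1 d) (y.1 e) := by
      rw [Mor.fiberMap_eq hp ha hP hd _ (x.1 d).2 (P.map_id _)]
      have e1 (e : P.Fiber b) : (x.1 d).comp e = (Mor.fiberConj hp ha (b' := a ≫ b) (x.1 d).1 (𝟙 _)
        (by rw [P.map_id, (x.1 d).2, Category.comp_id])).toFun e :=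
          Subtype.ext (congrArg (fun t => (x.1 d).1 ≫ t) (Category.comp_id _).symm)
      rw [e1, e1, Herd.Diff.map_val]
    exact (h2.symm.trans (congrArg _ h1.symm))

end Linear

/-! ### The untwisted case: difference groups of whole hom-sets -/

section Untwisted

variable (hp : T'.IsMaltsevOp p) (ha : ∀ k, Affine p (P.freeHom k) False)

/-- The set of all morphisms between two objects, as a herd. -/
noncomputable def Mor.homHerd (k n : ℕ) : Herd (T'.pow k ⟶ T'.pow n) :=
  (ha k).totalHerd hp n

/-- Composition on both sides, as a morphism of herds. -/
noncomputable def Mor.homConj {k' k n n' : ℕ} (l : T'.pow k' ⟶ T'.pow k)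
    (r : T'.pow n ⟶ T'.pow n') : (Mor.homHerd hp ha k n).Hom (Mor.homHerd hp ha k' n') where
  toFun x := l ≫ x ≫ r
  map_rel {x y} (h : P.map x = P.map y) := by
    change P.map (l ≫ x ≫ r) = P.map (l ≫ y ≫ r)
    rw [P.map_comp, P.map_comp, h, P.map_comp, P.map_comp]
  map_op {x y} z h := by
    change l ≫ triHom p x y z ≫ r = triHom p (l ≫ x ≫ r) (l ≫ y ≫ r) (l ≫ z ≫ r)
    rw [triHom_comp ha (show P.map x = P.map y from h) False.elim, comp_triHom]

lemma Mor.map_homConj (hd : P.DiamondHom p) {k' k n n' : ℕ} {l l' : T'.pow k' ⟶ T'.pow k}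
    {r r' : T'.pow n ⟶ T'.pow n'} (hl : P.map l = P.map l') (hr : P.map r = P.map r') :
    Herd.Diff.map (Mor.homConj hp ha l r) = Herd.Diff.map (Mor.homConj hp ha l' r') :=
  Herd.Diff.map_congr _ _ fun _ _ h =>
    -- Centrality implies affineness on fibres, so the computation of the linear case applies.
    Mor.triHom_conj hp (fun k _ _ t _ _ _ h _ => ha k t _ _ _ h False.elim) hd hl hr h

/-- The homomorphism of difference groups given by a pair of morphisms. -/
noncomputable def Mor.homMap (hP : P.Full) {k' k n n' : ℕ} (l : T.pow k' ⟶ T.pow k)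
    (r : T.pow n ⟶ T.pow n') : (Mor.homHerd hp ha k n).Diff →+ (Mor.homHerd hp ha k' n').Diff :=
  Herd.Diff.map (Mor.homConj hp ha (hP _ _ l).choose (hP _ _ r).choose)

lemma Mor.homMap_eq (hP : P.Full) (hd : P.DiamondHom p) {k' k n n' : ℕ} {l : T.pow k' ⟶ T.pow k}
    {r : T.pow n ⟶ T.pow n'} {l' : T'.pow k' ⟶ T'.pow k} {r' : T'.pow n ⟶ T'.pow n'}
    (hl : P.map l' = l) (hr : P.map r' = r) :
    Mor.homMap hp ha hP l r = Herd.Diff.map (Mor.homConj hp ha l' r') :=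
  Mor.map_homConj hp ha hd ((hP _ _ l).choose_spec.trans hl.symm)
    ((hP _ _ r).choose_spec.trans hr.symm)

lemma Mor.homMap_id (hP : P.Full) (hd : P.DiamondHom p) (k n : ℕ) :
    Mor.homMap hp ha hP (𝟙 (T.pow k)) (𝟙 (T.pow n)) = .id _ := by
  rw [Mor.homMap_eq hp ha hP hd (P.map_id _) (P.map_id _)]
  ext1 d
  exact Herd.Diff.map_id _ (fun x => (Category.id_comp _).trans (Category.comp_id _)) d

lemma Mor.homMap_comp (hP : P.Full) (hd : P.DiamondHom p) {k k' k'' n n' n'' : ℕ}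
    (l : T.pow k' ⟶ T.pow k) (r : T.pow n ⟶ T.pow n') (l' : T.pow k'' ⟶ T.pow k')
    (r' : T.pow n' ⟶ T.pow n'') : Mor.homMap hp ha hP (l' ≫ l) (r ≫ r') =
      (Mor.homMap hp ha hP l' r').comp (Mor.homMap hp ha hP l r) := by
  obtain ⟨l, rfl⟩ := hP _ _ l
  obtain ⟨r, rfl⟩ := hP _ _ r
  obtain ⟨l', rfl⟩ := hP _ _ l'
  obtain ⟨r', rfl⟩ := hP _ _ r'
  rw [Mor.homMap_eq hp ha hP hd rfl rfl, Mor.homMap_eq hp ha hP hd rfl rfl,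
    Mor.homMap_eq hp ha hP hd (P.map_comp _ _) (P.map_comp _ _)]
  ext1 d
  refine Herd.Diff.map_map _ _ _ (fun x => ?_) d
  change (l' ≫ l) ≫ x ≫ r ≫ r' = l' ≫ (l ≫ x ≫ r) ≫ r'
  simp only [Category.assoc]

/-- The bifunctor of difference groups. -/
noncomputable def Mor.homBifunctor (hP : P.Full) (hd : P.DiamondHom p) :
    T.Objᵒᵖ × T.Obj ⥤ AddCommGrpCat.{u} where
  obj b := .of (Mor.homHerd hp ha b.1.unop b.2).Diff
  map {b b'} f := AddCommGrpCat.ofHom (Mor.homMap hp ha hP (k' := b'.1.unop) (k := b.1.unop)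
    (n := b.2) (n' := b'.2) f.1.unop f.2)
  map_id b := AddCommGrpCat.hom_ext (Mor.homMap_id hp ha hP hd b.1.unop b.2)
  map_comp {b b' b''} f g := AddCommGrpCat.hom_ext
    (Mor.homMap_comp hp ha hP hd (k := b.1.unop) (k' := b'.1.unop) (k'' := b''.1.unop) (n := b.2)
      (n' := b'.2) (n'' := b''.2) f.1.unop f.2 g.1.unop g.2)

/-- The action of the difference group on a fibre. -/
@[reducible]
noncomputable def Mor.homTorsor (hP : P.Full) {k n : ℕ} (b : T.pow k ⟶ T.pow n) :
    AddTorsor (Mor.homHerd hp ha k n).Diff (P.Fiber b) where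
  vadd d e := ⟨d.1 e.1, (d.rel_val e.1).trans e.2⟩
  zero_vadd _ := rfl
  add_vadd _ _ _ := rfl
  vsub x y := .sub x.1 y.1 (x.2.trans y.2.symm)
  nonempty := (hP k n b).elim fun e he => ⟨⟨e, he⟩⟩
  vsub_vadd' x y := Subtype.ext (Herd.Diff.sub_val (H := Mor.homHerd hp ha k n) (x := x.1)
    (y := y.1) (x.2.trans y.2.symm))
  vadd_vsub' d x := Herd.Diff.ext_of_apply x.1
    (Herd.Diff.sub_val (H := Mor.homHerd hp ha k n) (d.rel_val x.1))

/-- The untwisted linear extension by the difference groups. -/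
noncomputable def Mor.untwistedExtension (hP : P.Full) (hd : P.DiamondHom p) :
    LinearExtension P (TwistedArrow.toProd ⋙ Mor.homBifunctor hp ha hP hd) where
  torsor b := Mor.homTorsor hp ha hP b
  vadd_comp_vadd {l m n a b} d e (x : (Mor.homHerd hp ha l m).Diff)
      (y : (Mor.homHerd hp ha m n).Diff) := by
    have h1 : (Mor.homMap hp ha hP (𝟙 _) b x).1 (d.1 ≫ e.1) = x.1 d.1 ≫ e.1 := by
      rw [Mor.homMap_eq hp ha hP hd (P.map_id _) e.2]
      have e1 (d : T'.pow l ⟶ T'.pow m) : d ≫ e.1 = (Mor.homConj hp ha (𝟙 _) e.1).toFun d :=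
        (Category.id_comp _).symm
      rw [e1, e1, Herd.Diff.map_val]
    have h2 : (Mor.homMap hp ha hP a (𝟙 _) y).1 (x.1 d.1 ≫ e.1) = x.1 d.1 ≫ y.1 e.1 := by
      rw [Mor.homMap_eq hp ha hP hd (l' := x.1 d.1) ((x.rel_val d.1).trans d.2) (P.map_id _)]
      have e1 (e : T'.pow m ⟶ T'.pow n) :
          x.1 d.1 ≫ e = (Mor.homConj hp ha (x.1 d.1) (𝟙 _)).toFun e :=
        congrArg (fun t => x.1 d.1 ≫ t) (Category.comp_id _).symm
      rw [e1, e1, Herd.Diff.map_val]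
    exact Subtype.ext (h2.symm.trans (congrArg _ h1.symm))

end Untwisted

/-- Affineness depends on a homomorphism only through its kernel. -/
lemma Mor.affine_freeHom {k : ℕ} (h : Affine p (P.unit (T'.free k)) c) :
    Affine p (P.freeHom k) c := fun _ _ t x y z hxy hyz =>
  h t x y z ((P.unit_free_eq_iff x y).2 hxy) fun hc => (P.unit_free_eq_iff y z).2 (hyz hc)

end Converse

end AlgTheory

theorem mainTheorem2 {T' T : AlgTheory.{u}} (hT' : T'.IsMaltsev) (hT : T.IsMaltsev)
    (P : AlgTheory.Mor T' T) :
    (P.IsLinear ↔ (∀ M : T'.Model, IsAbelianExtension (P.unit M)) ∧ P.Diamond) ∧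
    (P.IsUntwisted ↔ (∀ M : T'.Model, IsCentralExtension (P.unit M)) ∧ P.Diamond) := by
  obtain ⟨p, hp⟩ := id hT'
  refine ⟨⟨?_, ?_⟩, ⟨?_, ?_⟩⟩
  · rintro ⟨D, ⟨L⟩⟩
    refine ⟨fun M => ?_, L.parallelism.diamond⟩
    exact (AlgTheory.Mor.affine_unit L.full hT' hp (L.parallelism.affine hp) M).isAbelianExtension
      hp (AlgTheory.Mor.unit_surjective L.full hT' M)
  · rintro ⟨h, hd⟩
    exact ⟨_, ⟨AlgTheory.Mor.linearExtension hp
      (fun k => AlgTheory.Mor.affine_freeHom ((h (T'.free k)).affine hp))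
      (P.full_of_surjective fun n => (h (T'.free n)).surjective) (hd.diamondHom hp)⟩⟩
  · rintro ⟨D, ⟨L⟩⟩
    refine ⟨fun M => ?_, L.biparallelism.diamond⟩
    exact (AlgTheory.Mor.affine_unit L.full hT' hp (L.biparallelism.affine hp) M).isCentralExtension
      hp (AlgTheory.Mor.unit_surjective L.full hT' M)
  · rintro ⟨h, hd⟩
    exact ⟨_, ⟨AlgTheory.Mor.untwistedExtension hp
      (fun k => AlgTheory.Mor.affine_freeHom ((h (T'.free k)).affine hp))
      (P.full_of_surjective fun n => (h (T'.free n)).surjective) (hd.diamondHom hp)⟩⟩
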